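/- **Theorem (existence and uniqueness of pseudo-commutative contractive lifts).** Let $\underline T=(T_1,\dots,T_d)$ be a $d$-tuple of pairwise commuting contractions on a complex Hilbert space $\mathcal H$. Put $T=T_1\cdots T_d$ and let $T_{(j)}$ be the product of all $T_i$ with $i\ne j$. *Definitions.* A *pseudo-commutative contractive lift* of $(T_1,\dots,T_d,T)$ is a quadruple $(\Pi,\mathcal K,\underline S,V)$, where $\mathcal K$ is a Hilbert space, $\Pi:\mathcal H\to\mathcal K$ is an isometry, and $\underline S=(S_1,\dots,S_d)$ and $V$ consist of bounded operators on $\mathcal K$, such that 1. $(\Pi,\mathcal K,V)$ is the minimal isometric lift of $T$: $V$ is an isometry, $V^*\Pi=\Pi T^*$, and $\mathcal K=\overline{\operatorname{span}}\{V^n\Pi h: n\ge 0,\ h\in\mathcal H\}$; 2. with $S_j'=S_j^*V$, for each $j$ both $S_j$ and $S'_j$ commute with $V$, and $S_j^*\Pi=\Pi T_j^*$, $S_j'^*\Pi=\Pi T_{(j)}^*$. Two such lifts $(\Pi_1,\mathcal K_1,\underline S,V_1)$ and $(\Pi_2,\mathcal K_2,\underline R,V_2)$ are *unitarily equivalent*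 if there is a unitary $\tau:\mathcal K_1\to\mathcal K_2$ with $\tau S_j=R_j\tau$ for all $j$, $\tau V_1=V_2\tau$ and $\tau\Pi_1=\Pi_2$. Let $D_{T^*}=(I-TT^*)^{1/2}$ and $\mathcal D_{T^*}=\overline{\operatorname{Ran}}\,D_{T^*}$. The *fundamental operators* of $\underline T^*=(T_1^*,\dots,T_d^*)$ are the bounded operators $G_{j1},G_{j2}$ on $\mathcal D_{T^*}$, $j=1,\dots,d$, with $$T_j^*-T_{(j)}T^*=D_{T^*}G_{j1}D_{T^*},\qquad T_{(j)}^*-T_jT^*=D_{T^*}G_{j2}D_{T^*}.$$ Let $Q\ge 0$ be the square root of the strong limit of $T^nT^{*n}$. A *canonical commutative unitary tuple* of $\underline T$ consists of commuting unitaries $W_{\partial 1},\dots,W_{\partial d}$ on a Hilbert space $\mathcal R_D\supseteq\overline{\operatorname{Ran}}\,Q$ such that $W_{\partial j}^*Q=QT_j^*$ for all $j$ and, with $W_D=W_{\partial1}\cdots W_{\partial d}$, $\mathcal R_D=\overline{\operatorname{span}}\{W_D^nx: n\ge0,\ x\in\overline{\operatorname{Ran}}\,Q\}$. Finally, $H^2(\mathcal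 E)$ is the Hardy space of power series $\sum_{n\ge0}z^nf_n$ with coefficients in $\mathcal E$ and $\sum\|f_n\|^2<\infty$, and $M_\varphi$ is multiplication by $\varphi$. *Conclusions.* * **Existence.** There is a pseudo-commutative contractive lift of $(T_1,\dots,T_d,T)$, and it can be chosen with every $S_j$ a contraction. * **Douglas model.** The fundamental operators $G_{j1},G_{j2}$ of $\underline T^*$ exist and are unique, and a canonical commutative unitary tuple of $\underline T$ exists. For each such tuple, on $\mathcal K_D=H^2(\mathcal D_{T^*})\oplus\mathcal R_D$ the formula $$\Pi_Dh=\Big(\sum_{n\ge0}z^nD_{T^*}T^{*n}h\Big)\oplus Qh$$ defines an isometry, and with $$S_j^D=M_{G_{j1}^*+zG_{j2}}\oplus W_{\partial j},\qquad V_D=M_z\oplus W_D,$$ $(\Pi_D,\mathcal K_D,\underline S^D,V_D)$ is a pseudo-commutative contractive lift of $(T_1,\dots,T_d,T)$ with each $S_j^D$ a contraction. * **Uniqueness.** Any two pseudo-commutative contractive lifts of $(T_1,\dots,T_d,T)$ are unitarily equivalent. -/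

import Mathlib

open scoped InnerProduct ENNReal Topology

universe u v w x

namespace PseudoLift

section General

variable {H : Type*} [NormedAddCommGroup H] [InnerProductSpace ℂ H] [CompleteSpace H]
variable {K : Type*} [NormedAddCommGroup K] [InnerProductSpace ℂ K] [CompleteSpace K]

/-- The product `T = T₁ T₂ ⋯ T_d`. -/
noncomputable def tupleProd {d : ℕ} (T : Fin d → H →L[ℂ] H) : H →L[ℂ] H :=
  (List.ofFn T).prod

/-- The product `T_(j) = T₁ ⋯ T_{j-1} T_{j+1} ⋯ T_d`, with the factor of index `j` omitted. -/
noncomputable def omitProd {d : ℕ} (T : Fin d → H →L[ℂ] H) (j : Fin d) : H →L[ℂ] H :=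
  ((List.ofFn T).eraseIdx j).prod

/-- `(Π, K, V)` is a minimal isometric lift of the operator `T`. -/
structure IsMinimalIsometricLift (T : H →L[ℂ] H) (P : H →ₗᵢ[ℂ] K) (V : K →L[ℂ] K) : Prop where
  isometry : Isometry V
  lift : ∀ h : H, (V†) (P h) = P ((T†) h)
  minimal : (Submodule.span ℂ {x : K | ∃ (n : ℕ) (h : H), x = (V ^ n) (P h)}).topologicalClosure = ⊤

/-- `(Π, K, S, V)` is a pseudo-commutative contractive lift of `(T₁, …, T_d, T)`, `T = T₁ ⋯ T_d`.
Here `S'_j = S_j^* V`. -/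
structure IsPseudoCommutativeContractiveLift {d : ℕ} (T : Fin d → H →L[ℂ] H)
    (P : H →ₗᵢ[ℂ] K) (S : Fin d → K →L[ℂ] K) (V : K →L[ℂ] K) : Prop where
  minimalLift : IsMinimalIsometricLift (tupleProd T) P V
  commute : ∀ j, Commute (S j) V
  commute' : ∀ j, Commute (((S j)†) * V) V
  lift : ∀ j, ∀ h : H, ((S j)†) (P h) = P (((T j)†) h)
  lift' : ∀ j, ∀ h : H, ((((S j)†) * V)†) (P h) = P (((omitProd T j)†) h)

/-- Unitary equivalence of lifts of `(T₁, …, T_d, T)`: a unitary `τ : K₁ → K₂` that intertwines the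
operators and matches the embeddings. -/
def UnitarilyEquivalent {K' : Type*} [NormedAddCommGroup K'] [InnerProductSpace ℂ K']
    {d : ℕ} (P : H →ₗᵢ[ℂ] K) (S : Fin d → K →L[ℂ] K) (V : K →L[ℂ] K)
    (P' : H →ₗᵢ[ℂ] K') (R : Fin d → K' →L[ℂ] K') (V' : K' →L[ℂ] K') : Prop :=
  ∃ τ : K ≃ₗᵢ[ℂ] K', (∀ j, ∀ x : K, τ (S j x) = R j (τ x)) ∧ (∀ x : K, τ (V x) = V' (τ x)) ∧
    ∀ h : H, τ (P h) = P' h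

/-! ### Defect operators and fundamental operators -/

/-- The defect operator `D_{T^*} = (I - T T^*)^{1/2}` of the adjoint of a contraction `T`. -/
noncomputable def defectAdj (T : H →L[ℂ] H) : H →L[ℂ] H :=
  CFC.sqrt (1 - T * (T†))

/-- The defect space `𝒟_{T^*}`, the closure of the range of `D_{T^*}`. -/
noncomputable abbrev defectSpaceAdj (T : H →L[ℂ] H) : Submodule ℂ H :=
  (LinearMap.range (defectAdj T).toLinearMap).topologicalClosure

/-- `D_{T^*}` as an operator `H → 𝒟_{T^*}`. -/
noncomputable def defectAdjTo (T : H →L[ℂ] H) : H →L[ℂ] defectSpaceAdj T :=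
  (defectAdj T).codRestrict (defectSpaceAdj T)
    fun h => Submodule.le_topologicalClosure _ ⟨h, rfl⟩

/-- `G₁ j, G₂ j` on `𝒟_{T^*}`, `T = T₁ ⋯ T_d`, are the fundamental operators of the adjoint tuple
`(T₁^*, …, T_d^*)`: they satisfy `T_j^* - T_(j) T^* = D_{T^*} G_{j1} D_{T^*}` and
`T_(j)^* - T_j T^* = D_{T^*} G_{j2} D_{T^*}`. -/
def IsFundamentalAdj {d : ℕ} (T : Fin d → H →L[ℂ] H)
    (G₁ G₂ : Fin d → defectSpaceAdj (tupleProd T) →L[ℂ] defectSpaceAdj (tupleProd T)) : Prop :=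
  ∀ j, ∀ h : H,
    ((T j)†) h - omitProd T j (((tupleProd T)†) h) =
        defectAdj (tupleProd T) (G₁ j (defectAdjTo (tupleProd T) h) : H) ∧
    ((omitProd T j)†) h - T j (((tupleProd T)†) h) =
        defectAdj (tupleProd T) (G₂ j (defectAdjTo (tupleProd T) h) : H)

/-! ### The operator `Q` and the canonical unitary tuple -/

/-- For a contraction `T`, the operators `T^n T^{*n}` converge strongly. -/
theorem exists_asymptoticLimit (T : H →L[ℂ] H) (hT : ‖T‖ ≤ 1) :
    ∃ A : H →L[ℂ] H, ∀ x, Filter.Tendsto (fun n : ℕ => (T ^ n * (T†) ^ n) x)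
      Filter.atTop (𝓝 (A x)) := by
  set P : ℕ → H →L[ℂ] H := fun n => T ^ n * (T†) ^ n with hP
  have hadj : ∀ n, ((T†) ^ n)† = T ^ n := fun n => by
    rw [← ContinuousLinearMap.star_eq_adjoint, ← ContinuousLinearMap.star_eq_adjoint, star_pow,
      star_star]
  have hT' : ‖(T†)‖ ≤ 1 := by rwa [LinearIsometryEquiv.norm_map]
  have hinner : ∀ n x, inner ℂ (P n x) x = ((‖((T†) ^ n) x‖ ^ 2 : ℝ) : ℂ) := fun n x => by
    have : P n x = (((T†) ^ n)†) (((T†) ^ n) x) := by rw [hadj]; rfl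
    rw [this, ContinuousLinearMap.adjoint_inner_left, inner_self_eq_norm_sq_to_K]
    norm_cast
  have hanti : ∀ x, Antitone fun n => ‖((T†) ^ n) x‖ ^ 2 := fun x => by
    refine antitone_nat_of_succ_le fun n => ?_
    have : ((T†) ^ (n + 1)) x = (T†) (((T†) ^ n) x) := by rw [pow_succ']; rfl
    rw [this]
    gcongr
    exact ((T†).le_of_opNorm_le hT' _).trans (one_mul _).le
  have hnorm : ∀ n, ‖P n‖ ≤ 1 := fun n => by
    refine (norm_mul_le _ _).trans ?_
    have h1 : ‖(T†) ^ n‖ ≤ 1 := by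
      rcases n with _ | n
      · rw [pow_zero]; exact ContinuousLinearMap.norm_id_le
      · exact (norm_pow_le' _ n.succ_pos).trans (pow_le_one₀ (norm_nonneg _) hT')
    have h2 : ‖T ^ n‖ ≤ 1 := by
      rw [← hadj, LinearIsometryEquiv.norm_map]; exact h1
    exact mul_le_one₀ h2 (norm_nonneg _) h1
  have hreal : ∀ B : H →L[ℂ] H, (∀ x, ∃ r : ℝ, 0 ≤ r ∧ inner ℂ (B x) x = (r : ℂ)) → 0 ≤ B :=
    fun B hB => by
    rw [ContinuousLinearMap.nonneg_iff_isPositive, ContinuousLinearMap.isPositive_iff_complex]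
    intro x
    obtain ⟨r, hr, h⟩ := hB x
    rw [h]
    exact ⟨rfl, hr⟩
  have hpos : ∀ n, 0 ≤ P n := fun n => hreal _ fun x => ⟨_, by positivity, hinner n x⟩
  have hle : ∀ n m, n ≤ m → 0 ≤ P n - P m := fun n m h => hreal _ fun x =>
    ⟨_, sub_nonneg.2 (hanti x h), by
      rw [sub_apply, inner_sub_left, hinner, hinner]; push_cast; rfl⟩
  have key : ∀ n m, n ≤ m → ∀ x, ‖P n x - P m x‖ ^ 2 ≤
      ‖((T†) ^ n) x‖ ^ 2 - ‖((T†) ^ m) x‖ ^ 2 := fun n m h x => by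
    set B := P n - P m with hB
    have hB0 : 0 ≤ B := hle n m h
    have hBn : ‖B‖ ≤ 1 :=
      (CStarAlgebra.norm_le_norm_of_nonneg_of_le hB0
        (sub_le_self _ (hpos m))).trans (hnorm n)
    set C := CFC.sqrt B with hC
    have hCC : C * C = B := CFC.sqrt_mul_sqrt_self B hB0
    have hCs : star C = C := (IsSelfAdjoint.of_nonneg (CFC.sqrt_nonneg B)).star_eq
    have hCn : ‖C‖ ≤ 1 := by
      have : ‖C‖ * ‖C‖ ≤ 1 := by
        rw [← CStarRing.norm_star_mul_self, hCs, hCC]; exact hBn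
      nlinarith [norm_nonneg C]
    have h1 : ‖B x‖ ≤ ‖C x‖ := by
      rw [← hCC]
      exact (C.le_of_opNorm_le hCn _).trans (one_mul _).le
    have h2 : ((‖C x‖ ^ 2 : ℝ) : ℂ) =
        ((‖((T†) ^ n) x‖ ^ 2 - ‖((T†) ^ m) x‖ ^ 2 : ℝ) : ℂ) := by
      have e1 : inner ℂ (B x) x = ((‖C x‖ ^ 2 : ℝ) : ℂ) := by
        have : B x = (C†) (C x) := by
          rw [← ContinuousLinearMap.star_eq_adjoint, hCs, ← hCC]; rfl
        rw [this, ContinuousLinearMap.adjoint_inner_left, inner_self_eq_norm_sq_to_K]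
        norm_cast
      rw [← e1, hB, sub_apply, inner_sub_left, hinner, hinner]
      push_cast; ring
    have h3 := Complex.ofReal_injective h2
    rw [← h3]
    have : P n x - P m x = B x := rfl
    rw [this]
    gcongr
  have hconv : ∀ x, ∃ y, Filter.Tendsto (fun n => P n x) Filter.atTop (𝓝 y) := fun x => by
    apply cauchySeq_tendsto_of_complete
    have hc : CauchySeq fun n => ‖((T†) ^ n) x‖ ^ 2 :=
      (tendsto_atTop_ciInf (hanti x) ⟨0, by rintro _ ⟨n, rfl⟩; positivity⟩).cauchySeq
    rw [Metric.cauchySeq_iff'] at hc ⊢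
    intro ε hε
    obtain ⟨N, hN⟩ := hc (ε ^ 2) (by positivity)
    refine ⟨N, fun n hn => ?_⟩
    have h1 := hN n hn
    have h2 := key N n hn x
    rw [dist_comm, dist_eq_norm]
    rw [Real.dist_eq, abs_sub_comm] at h1
    exact lt_of_pow_lt_pow_left₀ 2 hε.le (h2.trans_lt ((le_abs_self _).trans_lt h1))
  choose g hg using hconv
  exact ⟨continuousLinearMapOfTendsto P (f := g) (tendsto_pi_nhds.2 hg), hg⟩

open Classical in
/-- The strong limit of `T^n T^{*n}` (which exists for each contraction `T`). -/
noncomputable def asymptoticLimit (T : H →L[ℂ] H) : H →L[ℂ] H :=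
  if h : ∃ A : H →L[ℂ] H, ∀ x, Filter.Tendsto (fun n : ℕ => (T ^ n * (T†) ^ n) x)
      Filter.atTop (𝓝 (A x)) then h.choose else 0

theorem asymptoticLimit_spec (T : H →L[ℂ] H) (hT : ‖T‖ ≤ 1) (x : H) :
    Filter.Tendsto (fun n : ℕ => (T ^ n * (T†) ^ n) x) Filter.atTop
      (𝓝 (asymptoticLimit T x)) := by
  have h := exists_asymptoticLimit T hT
  rw [asymptoticLimit, dif_pos h]
  exact h.choose_spec x

/-- The positive square root `Q` of the strong limit of `T^n T^{*n}`. -/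
noncomputable def asymptoticRoot (T : H →L[ℂ] H) : H →L[ℂ] H :=
  CFC.sqrt (asymptoticLimit T)

/-- The closure of the range of `Q`. -/
noncomputable abbrev asymptoticSpace (T : H →L[ℂ] H) : Submodule ℂ H :=
  (LinearMap.range (asymptoticRoot T).toLinearMap).topologicalClosure

/-- `Q` as an operator into the closure of its range. -/
noncomputable def asymptoticRootTo (T : H →L[ℂ] H) : H →L[ℂ] asymptoticSpace T :=
  (asymptoticRoot T).codRestrict (asymptoticSpace T)
    fun h => Submodule.le_topologicalClosure _ ⟨h, rfl⟩

/-- `W = (W_{∂1}, …, W_{∂d})` on the space `R` (which contains the closure of `Ran Q` through the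
isometric embedding `ι`) is a canonical commutative unitary tuple of `(T₁, …, T_d)`. The operators
`X_j^*` on the closure of `Ran Q` are given by `X_j^* Q = Q T_j^*`; the `W_{∂j}` are
commuting unitaries, `W_{∂j}^*` extends `X_j^*`, and for `W_D = W_{∂1} ⋯ W_{∂d}` the operator
`W_D^*` is the minimal unitary extension of `X^* = X_1^* ⋯ X_d^*`, that is,
`R` is the closed span of the vectors `W_D^n x`, `n ≥ 0`, `x` in the closure of `Ran Q`. -/
structure IsCanonicalUnitaryTuple {d : ℕ} (T : Fin d → H →L[ℂ] H)
    {R : Type*} [NormedAddCommGroup R] [InnerProductSpace ℂ R] [CompleteSpace R]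
    (ι : asymptoticSpace (tupleProd T) →ₗᵢ[ℂ] R) (W : Fin d → R →L[ℂ] R) : Prop where
  unitary : ∀ j, W j ∈ unitary (R →L[ℂ] R)
  commute : ∀ i j, Commute (W i) (W j)
  extends_adjoint : ∀ j, ∀ h : H, ((W j)†) (ι (asymptoticRootTo (tupleProd T) h)) =
    ι (asymptoticRootTo (tupleProd T) (((T j)†) h))
  minimal : (Submodule.span ℂ {x : R | ∃ (n : ℕ) (y : asymptoticSpace (tupleProd T)),
    x = (tupleProd W ^ n) (ι y)}).topologicalClosure = ⊤

end General

/-! ### The Hardy space and multiplication operators -/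

section Hardy

variable {E : Type*} [NormedAddCommGroup E]

/-- The Hardy space `H²(E)` of `E`-valued power series `f(z) = ∑ zⁿ fₙ` on the unit disk with
`‖f‖² = ∑ ‖fₙ‖² < ∞`, given by the sequence of Taylor coefficients. -/
abbrev Hardy (E : Type*) [NormedAddCommGroup E] : Type _ := lp (fun _ : ℕ => E) 2

theorem Hardy.hasSum_norm_sq (f : Hardy E) : HasSum (fun n => ‖f n‖ ^ 2) (‖f‖ ^ 2) := by
  have h := lp.hasSum_norm (p := 2) (by simp) f
  simpa using h

theorem memHardy_of_summable {g : ℕ → E} (h : Summable fun n => ‖g n‖ ^ 2) :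
    Memℓp (E := fun _ : ℕ => E) g 2 :=
  memℓp_gen (by simpa using h)

/-- The coefficients `0, f₀, f₁, …`. -/
def shiftCoeff (f : ℕ → E) : ℕ → E
  | 0 => 0
  | n + 1 => f n

theorem hasSum_shiftCoeff (f : Hardy E) : HasSum (fun n => ‖shiftCoeff f n‖ ^ 2) (‖f‖ ^ 2) := by
  rw [← hasSum_nat_add_iff' 1]
  simpa [shiftCoeff] using f.hasSum_norm_sq

variable [InnerProductSpace ℂ E]

/-- The value `f(z) = ∑ zⁿ fₙ`. -/
noncomputable def Hardy.eval (f : Hardy E) (z : ℂ) : E := ∑' n : ℕ, z ^ n • f n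

theorem summable_mulConst (A : E →L[ℂ] E) (f : Hardy E) :
    Summable fun n => ‖A (f n)‖ ^ 2 :=
  Summable.of_nonneg_of_le (fun _ => by positivity)
    (fun n => by rw [← mul_pow]; gcongr; exact A.le_opNorm _)
    (f.hasSum_norm_sq.summable.mul_left (‖A‖ ^ 2))

/-- Multiplication by the constant `A`: the coefficients `fₙ` become `A fₙ`. -/
noncomputable def mulConst (A : E →L[ℂ] E) : Hardy E →L[ℂ] Hardy E :=
  LinearMap.mkContinuous
    { toFun := fun f => ⟨fun n => A (f n), memHardy_of_summable (summable_mulConst A f)⟩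
      map_add' := fun f g => by ext n; exact map_add A (f n) (g n)
      map_smul' := fun c f => by ext n; exact map_smul A c (f n) }
    ‖A‖ (fun f => by
      refine (pow_le_pow_iff_left₀ (norm_nonneg _) ?_ two_ne_zero).1 ?_
      · positivity
      rw [mul_pow]
      refine hasSum_le (fun n => ?_) (Hardy.hasSum_norm_sq _)
        (f.hasSum_norm_sq.mul_left (‖A‖ ^ 2))
      rw [← mul_pow]
      gcongr
      exact A.le_opNorm _)

/-- The shift `M_z` as a linear map. -/
noncomputable def mulZLinear : Hardy E →ₗ[ℂ] Hardy E where
  toFun f := ⟨shiftCoeff f, memHardy_of_summable (hasSum_shiftCoeff f).summable⟩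
  map_add' f g := by
    ext n
    cases n with
    | zero => exact (add_zero (0 : E)).symm
    | succ n => rfl
  map_smul' c f := by
    ext n
    cases n with
    | zero => exact (smul_zero c).symm
    | succ n => rfl

/-- The shift `M_z`, multiplication by the coordinate function: the coefficients `f₀, f₁, …` become
`0, f₀, f₁, …`. -/
noncomputable def mulZ : Hardy E →L[ℂ] Hardy E :=
  mulZLinear.mkContinuous 1 (fun f => by
    rw [one_mul]
    refine (pow_le_pow_iff_left₀ (norm_nonneg _) (norm_nonneg _) two_ne_zero).1 ?_
    exact ((Hardy.hasSum_norm_sq (mulZLinear f)).unique (hasSum_shiftCoeff f)).le)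

theorem mulConst_apply (A : E →L[ℂ] E) (f : Hardy E) (n : ℕ) : mulConst A f n = A (f n) := rfl

theorem mulZ_apply (f : Hardy E) (n : ℕ) : mulZ f n = shiftCoeff f n := rfl

/-- The multiplication operator `M_{A + zB}`. -/
noncomputable def mulPencil (A B : E →L[ℂ] E) : Hardy E →L[ℂ] Hardy E :=
  mulConst A + mulZ * mulConst B

/-- `M_{A + zB}` is pointwise multiplication by `A + zB` on the unit disk. -/
theorem eval_mulPencil [CompleteSpace E] (A B : E →L[ℂ] E) (f : Hardy E) (z : ℂ) (hz : ‖z‖ < 1) :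
    (mulPencil A B f).eval z = A (f.eval z) + z • B (f.eval z) := by
  have hs : Summable fun n : ℕ => z ^ n • f n := by
    refine Summable.of_norm_bounded (g := fun n => ‖z‖ ^ n * ‖f‖)
      ((summable_geometric_of_lt_one (norm_nonneg z) hz).mul_right _) fun n => ?_
    rw [norm_smul, norm_pow]
    gcongr
    exact lp.norm_apply_le_norm two_ne_zero f n
  have hA : HasSum (fun n : ℕ => z ^ n • A (f n)) (A (f.eval z)) := by
    simpa [Hardy.eval] using A.hasSum hs.hasSum
  have hB : HasSum (fun n : ℕ => z ^ n • shiftCoeff (fun k => B (f k)) n) (z • B (f.eval z)) := by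
    rw [← hasSum_nat_add_iff' 1]
    simpa [Hardy.eval, shiftCoeff, pow_succ', mul_smul] using (B.hasSum hs.hasSum).const_smul z
  rw [← (hA.add hB).tsum_eq, Hardy.eval]
  refine tsum_congr fun n => ?_
  rw [← smul_add]
  congr 1

variable {R : Type*} [NormedAddCommGroup R] [InnerProductSpace ℂ R]

/-- The Hilbert space direct sum `A ⊕ B` of two operators. -/
noncomputable def directSum (A : E →L[ℂ] E) (B : R →L[ℂ] R) :
    WithLp 2 (E × R) →L[ℂ] WithLp 2 (E × R) :=
  (WithLp.prodContinuousLinearEquiv 2 ℂ E R).symm.toContinuousLinearMap ∘L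
    (A.prodMap B) ∘L (WithLp.prodContinuousLinearEquiv 2 ℂ E R).toContinuousLinearMap

end Hardy

end PseudoLift

/-!
For commuting contractions put `T = T₁ ⋯ T_d` and let `T_(j)` omit the factor `T_j`.

*Uniqueness.* The vectors `Vⁿ Π h` are total, and their inner products are determined by `T`, so
two lifts are related by a unitary `τ` with `τ V₁ⁿ Π₁ h = V₂ⁿ Π₂ h`
(`IsMinimalIsometricLift.exists_unitary`). The vector `S_j Π h` is determined by its inner products
with these: against `Π k` one finds `⟨k, T_j h⟩`, and against `Vⁿ⁺¹ Π k` one uses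
`V^* S_j Π h = (S_j^* V)^* Π h = Π T_(j)^* h`. As `S_j` commutes with `V`, it is determined on all
`Vⁿ Π h`.

*Fundamental operators.* For a commuting pair of contractions `A, B` with `T = AB`, the identities
`D_{T^*}² = B D_{A^*}² B^* + D_{B^*}² = D_{A^*}² + A D_{B^*}² A^*` produce two isometric columns
`(α, β)` and `(γ, δ)` on `𝒟_{T^*}`, and `G₁ = β^* δ`, `G₂ = γ^* α` are the fundamental operators
(`exists_fundamental_pair`). This factorization also shows that `M_{G₁^* + zG₂}` is a contraction,
without any unitary extension. Uniqueness holds because `D_{T^*}` is injective on `𝒟_{T^*}`.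

*Canonical unitary tuple.* `X_j^* Q h = Q T_j^* h` defines commuting contractions whose product is
isometric, hence commuting isometries. They act termwise on the direct limit along `X^*`, whose
completion carries the minimal unitary extension (`exists_unitary_extension`).

*Douglas model.* The embedding is isometric by telescoping. The relation
`G₁ D_{T^*} + G₂^* D_{T^*} T^* = D_{T^*} T_j^*` (`fundamental_add_adjoint`) gives the intertwining
for `S_j`. Since `M_{G₁^* + zG₂}^* M_z = M_{G₂^* + zG₁}`, the operator `S_j^* V` has the same shape
with `T_j` and `T_(j)` exchanged, so the same lemma applies to it. Minimality follows from
`Π h - V Π T^* h = D_{T^*} h ⊕ 0`, which puts `H²(𝒟_{T^*}) ⊕ 0` into the closed span. Existence of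
a lift is the model for any canonical unitary tuple.
-/

namespace PseudoLift

/-! ### Products of commuting tuples -/

section TupleProd

variable {H : Type*} [NormedAddCommGroup H] [InnerProductSpace ℂ H]

theorem tupleProd_eq_map {d : ℕ} (T : Fin d → H →L[ℂ] H) :
    tupleProd T = ((List.finRange d).map T).prod := by
  rw [tupleProd, List.ofFn_eq_map]

theorem omitProd_eq_map {d : ℕ} (T : Fin d → H →L[ℂ] H) (j : Fin d) :
    omitProd T j = (((List.finRange d).eraseIdx j).map T).prod := by
  rw [omitProd, List.ofFn_eq_map, List.eraseIdx_map]

theorem tupleProd_mem {d : ℕ} {T : Fin d → H →L[ℂ] H} (M : Submonoid (H →L[ℂ] H))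
    (h : ∀ i, T i ∈ M) : tupleProd T ∈ M := by
  rw [tupleProd_eq_map]
  refine list_prod_mem fun x hx => ?_
  obtain ⟨i, -, rfl⟩ := List.mem_map.1 hx
  exact h i

theorem omitProd_mem {d : ℕ} {T : Fin d → H →L[ℂ] H} (M : Submonoid (H →L[ℂ] H))
    (h : ∀ i, T i ∈ M) (j : Fin d) : omitProd T j ∈ M := by
  rw [omitProd_eq_map]
  refine list_prod_mem fun x hx => ?_
  obtain ⟨i, -, rfl⟩ := List.mem_map.1 hx
  exact h i

theorem commute_tupleProd {d : ℕ} {T : Fin d → H →L[ℂ] H} {A : H →L[ℂ] H}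
    (h : ∀ i, Commute A (T i)) : Commute A (tupleProd T) :=
  tupleProd_mem (Submonoid.centralizer {A})
    (fun i => Submonoid.mem_centralizer_iff.2 fun _ hB => hB ▸ (h i).eq) A rfl

theorem commute_omitProd {d : ℕ} {T : Fin d → H →L[ℂ] H} {A : H →L[ℂ] H}
    (h : ∀ i, Commute A (T i)) (j : Fin d) : Commute A (omitProd T j) :=
  omitProd_mem (Submonoid.centralizer {A})
    (fun i => Submonoid.mem_centralizer_iff.2 fun _ hB => hB ▸ (h i).eq) j A rfl

theorem mul_omitProd {d : ℕ} {T : Fin d → H →L[ℂ] H} (hcomm : ∀ i j, Commute (T i) (T j))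
    (j : Fin d) : T j * omitProd T j = tupleProd T := by
  have hj : (j : ℕ) < (List.ofFn T).length := by simp
  have := List.mul_prod_eraseIdx hj (fun a ha => by
    obtain ⟨i, rfl⟩ := List.mem_ofFn.1 (List.mem_of_mem_take ha)
    simpa using hcomm j i)
  simpa [tupleProd, omitProd] using this

/-- The contractions of `H` as a multiplicative monoid. -/
def contractions (H : Type*) [NormedAddCommGroup H] [InnerProductSpace ℂ H] :
    Submonoid (H →L[ℂ] H) where
  carrier := {A | ‖A‖ ≤ 1}
  one_mem' := ContinuousLinearMap.norm_id_le
  mul_mem' := fun {A B} hA hB => (norm_mul_le A B).trans (mul_le_one₀ hA (norm_nonneg _) hB)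

theorem norm_tupleProd_le {d : ℕ} {T : Fin d → H →L[ℂ] H} (hT : ∀ j, ‖T j‖ ≤ 1) :
    ‖tupleProd T‖ ≤ 1 :=
  tupleProd_mem (contractions H) hT

theorem norm_omitProd_le {d : ℕ} {T : Fin d → H →L[ℂ] H} (hT : ∀ j, ‖T j‖ ≤ 1) (j : Fin d) :
    ‖omitProd T j‖ ≤ 1 :=
  omitProd_mem (contractions H) hT j

variable [CompleteSpace H] {R : Type*} [NormedAddCommGroup R] [InnerProductSpace ℂ R]
  [CompleteSpace R]

theorem adjoint_mul (A B : H →L[ℂ] H) : (A * B)† = (B†) * (A†) :=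
  ContinuousLinearMap.adjoint_comp A B

/-- A map `J` that intertwines `T_i^*` with `W_i^*` intertwines the adjoints of products. Neither
linearity of `J` nor commutativity is needed. -/
theorem adjoint_map_prod_apply {ι : Type*} {T : ι → H →L[ℂ] H} {W : ι → R →L[ℂ] R} {J : H → R}
    (h : ∀ i x, ((W i)†) (J x) = J (((T i)†) x)) (l : List ι) (x : H) :
    (((l.map W).prod)†) (J x) = J ((((l.map T).prod)†) x) := by
  induction l generalizing x with
  | nil =>
    have h1 : (1 : R →L[ℂ] R)† = 1 := star_one _
    have h2 : (1 : H →L[ℂ] H)† = 1 := star_one _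
    simp [h1, h2]
  | cons i l ih =>
    simp only [List.map_cons, List.prod_cons, adjoint_mul, mul_apply_eq_comp]
    rw [h, ih]

theorem adjoint_tupleProd_apply {d : ℕ} {T : Fin d → H →L[ℂ] H} {W : Fin d → R →L[ℂ] R}
    {J : H → R} (h : ∀ i x, ((W i)†) (J x) = J (((T i)†) x)) (x : H) :
    ((tupleProd W)†) (J x) = J (((tupleProd T)†) x) := by
  rw [tupleProd_eq_map, tupleProd_eq_map]
  exact adjoint_map_prod_apply h _ x

theorem adjoint_omitProd_apply {d : ℕ} {T : Fin d → H →L[ℂ] H} {W : Fin d → R →L[ℂ] R}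
    {J : H → R} (h : ∀ i x, ((W i)†) (J x) = J (((T i)†) x)) (j : Fin d) (x : H) :
    ((omitProd W j)†) (J x) = J (((omitProd T j)†) x) := by
  rw [omitProd_eq_map, omitProd_eq_map]
  exact adjoint_map_prod_apply h _ x

theorem commute_adjoint {A B : H →L[ℂ] H} (h : Commute A B) : Commute (A†) (B†) := by
  simpa only [← ContinuousLinearMap.star_eq_adjoint] using h.star_star

theorem norm_adjoint_apply_le {A : H →L[ℂ] H} (hA : ‖A‖ ≤ 1) (x : H) : ‖(A†) x‖ ≤ ‖x‖ := by
  have : ‖A†‖ ≤ 1 := by rwa [LinearIsometryEquiv.norm_map]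
  exact ((A†).le_of_opNorm_le this x).trans (one_mul _).le

end TupleProd

/-! ### Square roots of positive operators and their ranges -/

section SquareRoot

variable {H : Type*} [NormedAddCommGroup H] [InnerProductSpace ℂ H] [CompleteSpace H]

theorem inner_apply_self_eq_norm_sqrt_sq {B : H →L[ℂ] H} (hB : 0 ≤ B) (x : H) :
    inner ℂ (B x) x = ((‖CFC.sqrt B x‖ ^ 2 : ℝ) : ℂ) := by
  have hs : star (CFC.sqrt B) = CFC.sqrt B :=
    (IsSelfAdjoint.of_nonneg (CFC.sqrt_nonneg B)).star_eq
  have h : B x = ((CFC.sqrt B)†) (CFC.sqrt B x) := by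
    rw [← ContinuousLinearMap.star_eq_adjoint, hs]
    exact (congrArg (fun C : H →L[ℂ] H => C x) (CFC.sqrt_mul_sqrt_self B hB)).symm
  rw [h, ContinuousLinearMap.adjoint_inner_left, inner_self_eq_norm_sq_to_K]
  norm_cast

omit [CompleteSpace H] in
theorem nonneg_of_inner_eq {B : H →L[ℂ] H} {r : H → ℝ} (hr : ∀ x, 0 ≤ r x)
    (h : ∀ x, inner ℂ (B x) x = (r x : ℂ)) : 0 ≤ B := by
  rw [ContinuousLinearMap.nonneg_iff_isPositive, ContinuousLinearMap.isPositive_iff_complex]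
  intro x
  rw [h]
  exact ⟨rfl, hr x⟩

theorem inner_sqrt_left (B : H →L[ℂ] H) (x y : H) :
    inner ℂ (CFC.sqrt B x) y = inner ℂ x (CFC.sqrt B y) := by
  have hs : (CFC.sqrt B)† = CFC.sqrt B :=
    (IsSelfAdjoint.of_nonneg (CFC.sqrt_nonneg B)).star_eq
  rw [← ContinuousLinearMap.adjoint_inner_right, hs]

omit [CompleteSpace H] in
/-- A symmetric operator is injective on the closure of its range. -/
theorem eq_zero_of_mem_closure_range {A : H →L[ℂ] H}
    (hA : ∀ x y, inner ℂ (A x) y = inner ℂ x (A y)) {x : H}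
    (hx : x ∈ (LinearMap.range A.toLinearMap).topologicalClosure) (h0 : A x = 0) : x = 0 := by
  have h1 : x ∈ (LinearMap.range A.toLinearMap)ᗮ := by
    rintro _ ⟨y, rfl⟩
    rw [ContinuousLinearMap.coe_coe, hA, h0, inner_zero_right]
  rw [← Submodule.orthogonal_closure] at h1
  exact inner_self_eq_zero.1 (h1 x hx)

omit [CompleteSpace H] in
theorem denseRange_codRestrict_closure {E : Type*} [NormedAddCommGroup E] [NormedSpace ℂ E]
    (A : E →L[ℂ] H) (h : ∀ x, A x ∈ (LinearMap.range A.toLinearMap).topologicalClosure) :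
    DenseRange (A.codRestrict (LinearMap.range A.toLinearMap).topologicalClosure h) := by
  intro y
  rw [closure_subtype, ← Set.range_comp]
  exact y.2

end SquareRoot

/-- A form of Douglas' factorization lemma: an operator dominated by one with dense range factors
through it by a contraction. -/
theorem exists_factor {E F G : Type*} [NormedAddCommGroup E] [InnerProductSpace ℂ E]
    [NormedAddCommGroup F] [InnerProductSpace ℂ F] [NormedAddCommGroup G] [InnerProductSpace ℂ G]
    [CompleteSpace G] (A : E →L[ℂ] F) (B : E →L[ℂ] G) (hA : DenseRange A)
    (h : ∀ x, ‖B x‖ ≤ ‖A x‖) : ∃ C : F →L[ℂ] G, ‖C‖ ≤ 1 ∧ ∀ x, C (A x) = B x :=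
  have h' : ∀ x, ‖B.toLinearMap x‖ ≤ 1 * ‖A.toLinearMap x‖ := by simpa using h
  ⟨B.toLinearMap.extendOfNorm A.toLinearMap, LinearMap.opNorm_extendOfNorm_le hA zero_le_one h',
    LinearMap.extendOfNorm_eq (f := B.toLinearMap) (e := A.toLinearMap) hA ⟨1, h'⟩⟩

/-! ### The defect operator and the asymptotic limit of a contraction -/

section Defect

variable {H : Type*} [NormedAddCommGroup H] [InnerProductSpace ℂ H] [CompleteSpace H]
variable {T : H →L[ℂ] H}

theorem inner_one_sub_mul_adjoint (T : H →L[ℂ] H) (x : H) :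
    inner ℂ ((1 - T * (T†)) x) x = ((‖x‖ ^ 2 - ‖(T†) x‖ ^ 2 : ℝ) : ℂ) := by
  rw [sub_apply, inner_sub_left, mul_apply_eq_comp, one_apply_eq_self,
    ← ContinuousLinearMap.adjoint_inner_right T,
    inner_self_eq_norm_sq_to_K, inner_self_eq_norm_sq_to_K]
  push_cast
  rfl

theorem one_sub_mul_adjoint_nonneg (hT : ‖T‖ ≤ 1) : 0 ≤ 1 - T * (T†) :=
  nonneg_of_inner_eq (fun x => sub_nonneg.2 (by gcongr; exact norm_adjoint_apply_le hT x))
    (inner_one_sub_mul_adjoint T)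

theorem norm_defectAdj_sq (hT : ‖T‖ ≤ 1) (x : H) :
    ‖defectAdj T x‖ ^ 2 = ‖x‖ ^ 2 - ‖(T†) x‖ ^ 2 := by
  have h := inner_apply_self_eq_norm_sqrt_sq (one_sub_mul_adjoint_nonneg hT) x
  rw [inner_one_sub_mul_adjoint] at h
  exact (Complex.ofReal_injective h).symm

theorem defectAdj_defectAdj (hT : ‖T‖ ≤ 1) (x : H) :
    defectAdj T (defectAdj T x) = x - T ((T†) x) :=
  congrArg (fun C : H →L[ℂ] H => C x)
    (CFC.sqrt_mul_sqrt_self _ (one_sub_mul_adjoint_nonneg hT))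

theorem inner_defectAdj_left (T : H →L[ℂ] H) (x y : H) :
    inner ℂ (defectAdj T x) y = inner ℂ x (defectAdj T y) :=
  inner_sqrt_left _ x y

theorem coe_defectAdjTo (T : H →L[ℂ] H) (x : H) : (defectAdjTo T x : H) = defectAdj T x := rfl

theorem norm_defectAdjTo (T : H →L[ℂ] H) (x : H) : ‖defectAdjTo T x‖ = ‖defectAdj T x‖ := rfl

theorem inner_defectAdjTo_left (T : H →L[ℂ] H) (x : H) (y : defectSpaceAdj T) :
    inner ℂ (defectAdjTo T x) y = inner ℂ x (defectAdj T y) :=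
  inner_defectAdj_left T x y

theorem denseRange_defectAdjTo (T : H →L[ℂ] H) : DenseRange (defectAdjTo T) :=
  denseRange_codRestrict_closure _ _

theorem defectAdj_injective (T : H →L[ℂ] H) {x y : defectSpaceAdj T}
    (h : defectAdj T x = defectAdj T y) : x = y := by
  refine sub_eq_zero.1 (Subtype.ext (eq_zero_of_mem_closure_range (inner_defectAdj_left T)
    (x - y).2 ?_))
  rw [Submodule.coe_sub, map_sub, h, sub_self]

theorem inner_pow_mul_adjoint_pow (T : H →L[ℂ] H) (n : ℕ) (x : H) :
    inner ℂ ((T ^ n * (T†) ^ n) x) x = ((‖((T†) ^ n) x‖ ^ 2 : ℝ) : ℂ) := by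
  have hadj : ((T†) ^ n) = (T ^ n)† := (star_pow T n).symm
  rw [mul_apply_eq_comp, ← ContinuousLinearMap.adjoint_inner_right, ← hadj,
    inner_self_eq_norm_sq_to_K]
  push_cast
  rfl

theorem inner_asymptoticLimit_tendsto (hT : ‖T‖ ≤ 1) (x : H) :
    Filter.Tendsto (fun n : ℕ => ((‖((T†) ^ n) x‖ ^ 2 : ℝ) : ℂ)) Filter.atTop
      (𝓝 (inner ℂ (asymptoticLimit T x) x)) := by
  simp only [← inner_pow_mul_adjoint_pow]
  exact (asymptoticLimit_spec T hT x).inner tendsto_const_nhds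

theorem asymptoticLimit_nonneg (hT : ‖T‖ ≤ 1) : 0 ≤ asymptoticLimit T := by
  have hre : ∀ x, Filter.Tendsto (fun n : ℕ => ‖((T†) ^ n) x‖ ^ 2) Filter.atTop
      (𝓝 (inner ℂ (asymptoticLimit T x) x).re) := fun x => by
    simpa only [Function.comp_def, Complex.ofReal_re] using
      (Complex.continuous_re.tendsto _).comp (inner_asymptoticLimit_tendsto hT x)
  refine nonneg_of_inner_eq (r := fun x => (inner ℂ (asymptoticLimit T x) x).re)
    (fun x => ge_of_tendsto' (hre x) fun n => by positivity) fun x => ?_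
  exact tendsto_nhds_unique (inner_asymptoticLimit_tendsto hT x)
    ((Complex.continuous_ofReal.tendsto _).comp (hre x))

theorem tendsto_norm_adjoint_pow_sq (hT : ‖T‖ ≤ 1) (x : H) :
    Filter.Tendsto (fun n : ℕ => ‖((T†) ^ n) x‖ ^ 2) Filter.atTop
      (𝓝 (‖asymptoticRoot T x‖ ^ 2)) := by
  have h := inner_asymptoticLimit_tendsto hT x
  rw [inner_apply_self_eq_norm_sqrt_sq (asymptoticLimit_nonneg hT)] at h
  exact (Complex.continuous_re.tendsto _).comp h

theorem denseRange_asymptoticRootTo (T : H →L[ℂ] H) : DenseRange (asymptoticRootTo T) :=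
  denseRange_codRestrict_closure _ _

/-- `Q h ↦ Q C^* h` is a contraction: `‖T^{*n} C^* h‖ = ‖C^* T^{*n} h‖ ≤ ‖T^{*n} h‖`, and
`‖Q h‖` is the limit of `‖T^{*n} h‖`. -/
theorem norm_asymptoticRootTo_le (hT : ‖T‖ ≤ 1) {C : H →L[ℂ] H} (hC : ‖C‖ ≤ 1)
    (hCT : Commute C T) (x : H) :
    ‖asymptoticRootTo T ((C†) x)‖ ≤ ‖asymptoticRootTo T x‖ := by
  refine (sq_le_sq₀ (norm_nonneg _) (norm_nonneg _)).1 ?_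
  refine le_of_tendsto_of_tendsto' (tendsto_norm_adjoint_pow_sq hT _)
    (tendsto_norm_adjoint_pow_sq hT x) fun n => ?_
  have h : ((T†) ^ n) ((C†) x) = (C†) (((T†) ^ n) x) :=
    congrArg (fun A : H →L[ℂ] H => A x) ((commute_adjoint hCT).pow_right n).eq.symm
  rw [h]
  gcongr
  exact norm_adjoint_apply_le hC _

theorem norm_asymptoticRootTo_adjoint (hT : ‖T‖ ≤ 1) (x : H) :
    ‖asymptoticRootTo T ((T†) x)‖ = ‖asymptoticRootTo T x‖ := by
  refine (sq_eq_sq₀ (norm_nonneg _) (norm_nonneg _)).1 ?_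
  refine tendsto_nhds_unique (tendsto_norm_adjoint_pow_sq hT _) ?_
  exact (Filter.tendsto_add_atTop_iff_nat 1).2 (tendsto_norm_adjoint_pow_sq hT x)

end Defect

/-! ### Operators on the Hardy space -/

section HardyOperators

variable {E : Type*} [NormedAddCommGroup E] [InnerProductSpace ℂ E]

theorem mulZ_single (n : ℕ) (e : E) :
    mulZ (lp.single 2 n e : Hardy E) = lp.single 2 (n + 1) e := by
  ext m
  rw [mulZ_apply]
  cases m with
  | zero => simp [shiftCoeff, lp.single_apply]
  | succ m => simp [shiftCoeff, lp.single_apply, Pi.single_apply]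

theorem mulZ_pow_single (n : ℕ) (e : E) :
    (mulZ ^ n) (lp.single 2 0 e : Hardy E) = lp.single 2 n e := by
  induction n with
  | zero => rfl
  | succ n ih => rw [pow_succ', mul_apply_eq_comp, ih, mulZ_single]

theorem mulConst_single (A : E →L[ℂ] E) (n : ℕ) (e : E) :
    mulConst A (lp.single 2 n e : Hardy E) = lp.single 2 n (A e) := by
  ext m
  rw [mulConst_apply]
  rcases eq_or_ne m n with rfl | h
  · simp
  · simp [lp.single_apply, h]

theorem commute_mulConst_mulZ (A : E →L[ℂ] E) : Commute (mulConst A) (mulZ : Hardy E →L[ℂ] _) := by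
  ext f n
  simp only [mul_apply_eq_comp, mulConst_apply, mulZ_apply]
  cases n with
  | zero => exact map_zero A
  | succ n => rfl

theorem commute_mulPencil_mulZ (A B : E →L[ℂ] E) :
    Commute (mulPencil A B) (mulZ : Hardy E →L[ℂ] _) :=
  (commute_mulConst_mulZ A).add_left ((Commute.refl _).mul_left (commute_mulConst_mulZ B))

theorem norm_mulZ_apply (f : Hardy E) : ‖mulZ f‖ = ‖f‖ :=
  (sq_eq_sq₀ (norm_nonneg _) (norm_nonneg _)).1
    ((Hardy.hasSum_norm_sq (mulZ f)).unique (hasSum_shiftCoeff f))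

theorem inner_single_left (n : ℕ) (e : E) (f : Hardy E) :
    inner ℂ (lp.single 2 n e : Hardy E) f = inner ℂ e (f n) :=
  lp.inner_single_left (𝕜 := ℂ) (G := fun _ : ℕ => E) n e f

variable [CompleteSpace E]

/-- The adjoint of `M_z` is the backward shift. -/
theorem adjoint_mulZ_apply (f : Hardy E) (n : ℕ) : ((mulZ : Hardy E →L[ℂ] _)†) f n = f (n + 1) := by
  refine ext_inner_left ℂ fun e : E => (inner_single_left n e _).symm.trans ?_
  rw [ContinuousLinearMap.adjoint_inner_right, mulZ_single]
  exact inner_single_left (n + 1) e f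

theorem adjoint_mulConst_apply (A : E →L[ℂ] E) (f : Hardy E) (n : ℕ) :
    ((mulConst A)†) f n = (A†) (f n) := by
  refine ext_inner_left ℂ fun e : E => (inner_single_left n e _).symm.trans ?_
  rw [ContinuousLinearMap.adjoint_inner_right, mulConst_single]
  exact (inner_single_left n (A e) f).trans (A.adjoint_inner_right e (f n)).symm

theorem adjoint_mulPencil_apply (A B : E →L[ℂ] E) (f : Hardy E) (n : ℕ) :
    ((mulPencil A B)†) f n = (A†) (f n) + (B†) (f (n + 1)) := by
  rw [mulPencil, map_add, adjoint_mul, add_apply, mul_apply_eq_comp]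
  exact congrArg₂ (· + ·) (adjoint_mulConst_apply A f n)
    ((adjoint_mulConst_apply B _ n).trans (congrArg (B†) (adjoint_mulZ_apply f n)))

/-- For a pencil `S = M_{A + zB}` the operator `S^* M_z` is the pencil `M_{B^* + zA^*}`. -/
theorem adjoint_mulPencil_mul_mulZ (A B : E →L[ℂ] E) :
    ((mulPencil A B)†) * mulZ = mulPencil (B†) (A†) := by
  ext f n
  have h : mulPencil (B†) (A†) f n = (B†) (f n) + shiftCoeff (fun k => (A†) (f k)) n := by
    cases n <;> rfl
  rw [mul_apply_eq_comp, adjoint_mulPencil_apply, h, mulZ_apply, mulZ_apply]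
  cases n with
  | zero => simp [shiftCoeff]
  | succ n => simp [shiftCoeff, add_comm]

/-- If the columns `(α, β)` and `(γ, δ)` are contractions, then `M_φ` with
`φ(z) = δ^* β + z γ^* α` is one: it is the contraction `f ↦ (zα f, β f)` followed by the
contraction `(x, y) ↦ γ^* x + δ^* y`. -/
theorem norm_mulPencil_le_one {F : Type*} [NormedAddCommGroup F] [InnerProductSpace ℂ F]
    [CompleteSpace F] {α β γ δ : E →L[ℂ] F} (h₁ : ∀ x, ‖α x‖ ^ 2 + ‖β x‖ ^ 2 ≤ ‖x‖ ^ 2)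
    (h₂ : ∀ x, ‖γ x‖ ^ 2 + ‖δ x‖ ^ 2 ≤ ‖x‖ ^ 2) :
    ‖mulPencil ((δ†) ∘L β) ((γ†) ∘L α)‖ ≤ 1 := by
  -- the row `(γ^*, δ^*)` is the adjoint of the column `(γ, δ)`
  have hrow : ∀ x y : F, ‖(δ†) y + (γ†) x‖ ^ 2 ≤ ‖y‖ ^ 2 + ‖x‖ ^ 2 := fun x y => by
    set w := (δ†) y + (γ†) x with hw
    have h : (inner ℂ w w) = inner ℂ y (δ w) + inner ℂ x (γ w) := by
      rw [← ContinuousLinearMap.adjoint_inner_left, ← ContinuousLinearMap.adjoint_inner_left,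
        ← inner_add_left]
    have h' : ‖w‖ ^ 2 ≤ ‖y‖ * ‖δ w‖ + ‖x‖ * ‖γ w‖ := by
      calc ‖w‖ ^ 2 = ‖inner ℂ w w‖ := by rw [inner_self_eq_norm_sq_to_K]; simp
        _ ≤ ‖inner ℂ y (δ w)‖ + ‖inner ℂ x (γ w)‖ := by rw [h]; exact norm_add_le _ _
        _ ≤ _ := add_le_add (norm_inner_le_norm _ _) (norm_inner_le_norm _ _)
    nlinarith [h₂ w, sq_nonneg (‖y‖ - ‖δ w‖), sq_nonneg (‖x‖ - ‖γ w‖)]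
  refine ContinuousLinearMap.opNorm_le_bound _ zero_le_one fun f => ?_
  rw [one_mul]
  refine (sq_le_sq₀ (norm_nonneg _) (norm_nonneg _)).1 ?_
  have hs : ∀ A : E →L[ℂ] F, Summable fun n => ‖A (f n)‖ ^ 2 := fun A =>
    Summable.of_nonneg_of_le (fun _ => by positivity)
      (fun n => by rw [← mul_pow]; gcongr; exact A.le_opNorm _)
      (f.hasSum_norm_sq.summable.mul_left (‖A‖ ^ 2))
  have hα : HasSum (fun n => ‖shiftCoeff (fun k => α (f k)) n‖ ^ 2) (∑' n, ‖α (f n)‖ ^ 2) := by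
    rw [← hasSum_nat_add_iff' 1]
    simpa [shiftCoeff] using (hs α).hasSum
  calc ‖mulPencil ((δ†) ∘L β) ((γ†) ∘L α) f‖ ^ 2
      ≤ ∑' n, ‖β (f n)‖ ^ 2 + ∑' n, ‖α (f n)‖ ^ 2 := by
        refine hasSum_le (fun n => ?_) (Hardy.hasSum_norm_sq _) ((hs β).hasSum.add hα)
        have h : mulPencil ((δ†) ∘L β) ((γ†) ∘L α) f n =
            (δ†) (β (f n)) + (γ†) (shiftCoeff (fun k => α (f k)) n) := by
          cases n with
          | zero => exact congrArg₂ (· + ·) rfl (map_zero (γ†)).symm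
          | succ n => rfl
        rw [h]
        exact hrow _ _
    _ ≤ ‖f‖ ^ 2 := by
        refine hasSum_le (fun n => ?_) ((hs β).hasSum.add (hs α).hasSum) f.hasSum_norm_sq
        rw [add_comm]
        exact h₁ _

end HardyOperators

/-! ### Direct sums of operators -/

section DirectSum

variable {E : Type*} [NormedAddCommGroup E] [InnerProductSpace ℂ E]
variable {R : Type*} [NormedAddCommGroup R] [InnerProductSpace ℂ R]

theorem directSum_fst (A : E →L[ℂ] E) (B : R →L[ℂ] R) (x : WithLp 2 (E × R)) :
    (directSum A B x).fst = A x.fst := rfl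

theorem directSum_mul (A A' : E →L[ℂ] E) (B B' : R →L[ℂ] R) :
    directSum A B * directSum A' B' = directSum (A * A') (B * B') := rfl

theorem directSum_pow (A : E →L[ℂ] E) (B : R →L[ℂ] R) (n : ℕ) :
    directSum A B ^ n = directSum (A ^ n) (B ^ n) := by
  induction n with
  | zero => rfl
  | succ n ih => rw [pow_succ, pow_succ, pow_succ, ih, directSum_mul]

theorem commute_directSum {A A' : E →L[ℂ] E} {B B' : R →L[ℂ] R} (hA : Commute A A')
    (hB : Commute B B') : Commute (directSum A B) (directSum A' B') := by
  rw [commute_iff_eq, directSum_mul, directSum_mul, hA.eq, hB.eq]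

theorem directSum_norm_sq_apply (A : E →L[ℂ] E) (B : R →L[ℂ] R) (x : WithLp 2 (E × R)) :
    ‖directSum A B x‖ ^ 2 = ‖A x.fst‖ ^ 2 + ‖B x.snd‖ ^ 2 :=
  WithLp.prod_norm_sq_eq_of_L2 _

theorem norm_directSum_le_one {A : E →L[ℂ] E} {B : R →L[ℂ] R} (hA : ‖A‖ ≤ 1) (hB : ‖B‖ ≤ 1) :
    ‖directSum A B‖ ≤ 1 := by
  refine ContinuousLinearMap.opNorm_le_bound _ zero_le_one fun x => ?_
  rw [one_mul]
  refine (sq_le_sq₀ (norm_nonneg _) (norm_nonneg _)).1 ?_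
  rw [directSum_norm_sq_apply, WithLp.prod_norm_sq_eq_of_L2]
  gcongr
  · exact (A.le_of_opNorm_le hA _).trans (one_mul _).le
  · exact (B.le_of_opNorm_le hB _).trans (one_mul _).le

theorem adjoint_directSum [CompleteSpace E] [CompleteSpace R] (A : E →L[ℂ] E) (B : R →L[ℂ] R) :
    (directSum A B)† = directSum (A†) (B†) := by
  symm
  rw [ContinuousLinearMap.eq_adjoint_iff]
  intro x y
  rw [WithLp.prod_inner_apply, WithLp.prod_inner_apply]
  exact congrArg₂ (· + ·) (A.adjoint_inner_left _ _) (B.adjoint_inner_left _ _)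

end DirectSum

/-! ### Fundamental operators -/

section Fundamental

variable {H : Type*} [NormedAddCommGroup H] [InnerProductSpace ℂ H] [CompleteSpace H]
variable {A B T : H →L[ℂ] H}

/-- For a commuting pair of contractions `A, B` with product `T`, the fundamental operators exist
and their pencil is a contractive multiplier. Since
`1 - TT^* = (1 - BB^*) + B(1 - AA^*)B^* = (1 - AA^*) + A(1 - BB^*)A^*`, the maps
`D_{T^*}h ↦ (D_{A^*}B^*h, D_{B^*}h)` and `D_{T^*}h ↦ (D_{A^*}h, D_{B^*}A^*h)` are isometries
`(α, β)` and `(γ, δ)`, and the operators are `β^* δ` and `γ^* α`. -/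
theorem exists_fundamental_pair (hA : ‖A‖ ≤ 1) (hB : ‖B‖ ≤ 1) (hAB : A * B = T)
    (hBA : B * A = T) :
    ∃ G₁ G₂ : defectSpaceAdj T →L[ℂ] defectSpaceAdj T,
      (∀ h, (A†) h - B ((T†) h) = defectAdj T (G₁ (defectAdjTo T h))) ∧
      (∀ h, (B†) h - A ((T†) h) = defectAdj T (G₂ (defectAdjTo T h))) ∧
      ‖mulPencil (G₁†) G₂‖ ≤ 1 := by
  have hT : ‖T‖ ≤ 1 := hAB ▸ (norm_mul_le A B).trans (mul_le_one₀ hA (norm_nonneg _) hB)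
  have hTA : ∀ h, (T†) h = (A†) ((B†) h) := fun h => by
    rw [← hBA, adjoint_mul, mul_apply_eq_comp]
  have hTB : ∀ h, (T†) h = (B†) ((A†) h) := fun h => by
    rw [← hAB, adjoint_mul, mul_apply_eq_comp]
  have hsum₁ : ∀ h, ‖defectAdj A ((B†) h)‖ ^ 2 + ‖defectAdj B h‖ ^ 2 = ‖defectAdjTo T h‖ ^ 2 :=
    fun h => by
      rw [norm_defectAdjTo, norm_defectAdj_sq hA, norm_defectAdj_sq hB, norm_defectAdj_sq hT, hTA]
      ring
  have hsum₂ : ∀ h, ‖defectAdj A h‖ ^ 2 + ‖defectAdj B ((A†) h)‖ ^ 2 = ‖defectAdjTo T h‖ ^ 2 :=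
    fun h => by
      rw [norm_defectAdjTo, norm_defectAdj_sq hA, norm_defectAdj_sq hB, norm_defectAdj_sq hT, hTB]
      ring
  have hle : ∀ {a b : ℝ}, 0 ≤ b → a ^ 2 ≤ b ^ 2 → a ≤ b := fun hb h => abs_le_of_sq_le_sq' h hb |>.2
  have hd := denseRange_defectAdjTo T
  obtain ⟨α, -, hα⟩ := exists_factor (defectAdjTo T) (defectAdj A ∘L (B†)) hd fun h =>
    hle (norm_nonneg _) (by rw [← hsum₁]; exact le_add_of_nonneg_right (by positivity))
  obtain ⟨β, -, hβ⟩ := exists_factor (defectAdjTo T) (defectAdj B) hd fun h =>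
    hle (norm_nonneg _) (by rw [← hsum₁]; exact le_add_of_nonneg_left (by positivity))
  obtain ⟨γ, -, hγ⟩ := exists_factor (defectAdjTo T) (defectAdj A) hd fun h =>
    hle (norm_nonneg _) (by rw [← hsum₂]; exact le_add_of_nonneg_right (by positivity))
  obtain ⟨δ, -, hδ⟩ := exists_factor (defectAdjTo T) (defectAdj B ∘L (A†)) hd fun h =>
    hle (norm_nonneg _) (by rw [← hsum₂]; exact le_add_of_nonneg_left (by positivity))
  simp only [ContinuousLinearMap.comp_apply] at hα hδ
  refine ⟨(β†) ∘L δ, (γ†) ∘L α, fun h => ?_, fun h => ?_, ?_⟩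
  · refine ext_inner_left ℂ fun k => ?_
    rw [← inner_defectAdjTo_left, ContinuousLinearMap.comp_apply,
      ContinuousLinearMap.adjoint_inner_right, hβ, hδ, inner_defectAdj_left,
      defectAdj_defectAdj hB, hTB]
  · refine ext_inner_left ℂ fun k => ?_
    rw [← inner_defectAdjTo_left, ContinuousLinearMap.comp_apply,
      ContinuousLinearMap.adjoint_inner_right, hγ, hα, inner_defectAdj_left,
      defectAdj_defectAdj hA, hTA]
  · rw [ContinuousLinearMap.adjoint_comp, ContinuousLinearMap.adjoint_adjoint]
    refine norm_mulPencil_le_one (fun x => ?_) fun x => ?_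
    · refine hd.induction_on (p := fun x => ‖α x‖ ^ 2 + ‖β x‖ ^ 2 ≤ ‖x‖ ^ 2) x
        (isClosed_le (by fun_prop) (by fun_prop)) fun h => ?_
      rw [hα, hβ, hsum₁]
    · refine hd.induction_on (p := fun x => ‖γ x‖ ^ 2 + ‖δ x‖ ^ 2 ≤ ‖x‖ ^ 2) x
        (isClosed_le (by fun_prop) (by fun_prop)) fun h => ?_
      rw [hγ, hδ, hsum₂]

theorem eq_of_defectAdj_comp_eq {G G' : defectSpaceAdj T →L[ℂ] defectSpaceAdj T}
    (h : ∀ x, defectAdj T (G (defectAdjTo T x)) = defectAdj T (G' (defectAdjTo T x))) :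
    G = G' := by
  refine DFunLike.coe_injective ((denseRange_defectAdjTo T).equalizer G.continuous G'.continuous ?_)
  funext x
  exact defectAdj_injective T (h x)

/-- The identity `G₁ D_{T^*} + G₂^* D_{T^*} T^* = D_{T^*} A^*`, which makes the Douglas embedding
intertwine `A^*` with the adjoint of `M_{G₁^* + zG₂}`. -/
theorem fundamental_add_adjoint (hT : ‖T‖ ≤ 1) (hAT : Commute A T)
    {G₁ G₂ : defectSpaceAdj T →L[ℂ] defectSpaceAdj T}
    (h₁ : ∀ h, (A†) h - B ((T†) h) = defectAdj T (G₁ (defectAdjTo T h)))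
    (h₂ : ∀ h, (B†) h - A ((T†) h) = defectAdj T (G₂ (defectAdjTo T h))) (h : H) :
    G₁ (defectAdjTo T h) + (G₂†) (defectAdjTo T ((T†) h)) = defectAdjTo T ((A†) h) := by
  -- the adjoint of the second relation: `D G₂^* D = B - T A^*`
  have h₂' : ∀ k, defectAdj T ((G₂†) (defectAdjTo T k)) = B k - T ((A†) k) := fun k => by
    refine ext_inner_left ℂ fun m => ?_
    rw [← inner_defectAdjTo_left, ContinuousLinearMap.adjoint_inner_right,
      ← inner_conj_symm, inner_defectAdjTo_left, ← h₂, inner_conj_symm, inner_sub_left,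
      inner_sub_right, ContinuousLinearMap.adjoint_inner_left,
      ← ContinuousLinearMap.adjoint_inner_right A, ContinuousLinearMap.adjoint_inner_left]
  have hc : (A†) ((T†) h) = (T†) ((A†) h) :=
    congrArg (fun C : H →L[ℂ] H => C h) (commute_adjoint hAT).eq
  refine defectAdj_injective T ?_
  rw [Submodule.coe_add, map_add, ← h₁, h₂', coe_defectAdjTo, defectAdj_defectAdj hT, hc]
  abel

end Fundamental

/-! ### Unitary extension of commuting isometries -/

section UnitaryExtension

variable {Q : Type*} [NormedAddCommGroup Q] [InnerProductSpace ℂ Q]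

/-- The sequences that are eventually an orbit of the isometry `Y`. Modulo eventual equality they
form the direct limit of `Q → Q → Q → ⋯` along `Y`. -/
def orbitSubmodule (Y : Q →ₗᵢ[ℂ] Q) : Submodule ℂ (ℕ → Q) where
  carrier := {s | ∀ᶠ n in Filter.atTop, s (n + 1) = Y (s n)}
  zero_mem' := Filter.Eventually.of_forall fun _ => (map_zero Y).symm
  add_mem' := fun {s t} hs ht => by
    filter_upwards [hs, ht] with n h₁ h₂
    rw [Pi.add_apply, Pi.add_apply, h₁, h₂, map_add]
  smul_mem' := fun c s hs => by
    filter_upwards [hs] with n h₁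
    rw [Pi.smul_apply, Pi.smul_apply, h₁, map_smul]

/-- The eventual orbits of `Y` as a type of their own, which does not carry the topology of
pointwise convergence. -/
def EventualOrbit (Y : Q →ₗᵢ[ℂ] Q) : Type _ := orbitSubmodule Y

namespace EventualOrbit

variable {Y : Q →ₗᵢ[ℂ] Q}

noncomputable instance : AddCommGroup (EventualOrbit Y) :=
  inferInstanceAs (AddCommGroup (orbitSubmodule Y))

noncomputable instance : Module ℂ (EventualOrbit Y) :=
  inferInstanceAs (Module ℂ (orbitSubmodule Y))

instance : CoeFun (EventualOrbit Y) fun _ => ℕ → Q := ⟨Subtype.val⟩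

theorem exists_tail (s : EventualOrbit Y) : ∃ N, ∀ n, N ≤ n → s n = (Y ^ (n - N)) (s N) := by
  obtain ⟨N, hN⟩ := Filter.eventually_atTop.1 s.2
  refine ⟨N, fun n hn => ?_⟩
  induction n, hn using Nat.le_induction with
  | base => rw [Nat.sub_self]; rfl
  | succ n hn ih =>
    rw [hN n hn, ih, Nat.succ_sub hn, pow_succ']
    rfl

theorem exists_eventually_inner_eq (s t : EventualOrbit Y) :
    ∃ c : ℂ, ∀ᶠ n in Filter.atTop, inner ℂ (s n) (t n) = c := by
  obtain ⟨N, hN⟩ := Filter.eventually_atTop.1 (s.2.and t.2)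
  refine ⟨inner ℂ (s N) (t N), Filter.eventually_atTop.2 ⟨N, fun n hn => ?_⟩⟩
  induction n, hn using Nat.le_induction with
  | base => rfl
  | succ n hn ih => rw [(hN n hn).1, (hN n hn).2, Y.inner_map_map, ih]

/-- The inner product of two eventual orbits is the eventual value of the inner products of their
terms. -/
noncomputable instance : Inner ℂ (EventualOrbit Y) :=
  ⟨fun s t => (exists_eventually_inner_eq s t).choose⟩

theorem eventually_inner_eq (s t : EventualOrbit Y) :
    ∀ᶠ n in Filter.atTop, inner ℂ (s n) (t n) = inner ℂ s t :=
  (exists_eventually_inner_eq s t).choose_spec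

/-- The positive semidefinite form on the eventual orbits. -/
noncomputable instance core : PreInnerProductSpace.Core ℂ (EventualOrbit Y) where
  conj_inner_symm s t := by
    obtain ⟨n, h₁, h₂⟩ := ((eventually_inner_eq s t).and (eventually_inner_eq t s)).exists
    rw [← h₁, ← h₂, inner_conj_symm]
  re_inner_nonneg s := by
    obtain ⟨n, h⟩ := (eventually_inner_eq s s).exists
    rw [← h]
    exact inner_self_nonneg
  add_left s t r := by
    obtain ⟨n, h₁, h₂, h₃⟩ := ((eventually_inner_eq (s + t) r).and
      ((eventually_inner_eq s r).and (eventually_inner_eq t r))).exists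
    rw [← h₁, ← h₂, ← h₃]
    exact inner_add_left _ _ _
  smul_left s t c := by
    obtain ⟨n, h₁, h₂⟩ := ((eventually_inner_eq (c • s) t).and (eventually_inner_eq s t)).exists
    rw [← h₁, ← h₂]
    exact inner_smul_left _ _ _

noncomputable instance : SeminormedAddCommGroup (EventualOrbit Y) :=
  InnerProductSpace.Core.toSeminormedAddCommGroup (𝕜 := ℂ)

noncomputable instance : InnerProductSpace ℂ (EventualOrbit Y) :=
  InnerProductSpace.ofCore core

theorem eventually_norm_eq (s : EventualOrbit Y) : ∀ᶠ n in Filter.atTop, ‖s n‖ = ‖s‖ := by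
  filter_upwards [eventually_inner_eq s s] with n h
  rw [norm_eq_sqrt_re_inner (𝕜 := ℂ), h, norm_eq_sqrt_re_inner (𝕜 := ℂ) s]

theorem coe_eq_of_eventually_eq {s t : EventualOrbit Y} (h : ∀ᶠ n in Filter.atTop, s n = t n) :
    (s : UniformSpace.Completion (EventualOrbit Y)) = t := by
  obtain ⟨n, h₁, h₂⟩ := (h.and (eventually_norm_eq (s - t))).exists
  rw [← sub_eq_zero, ← UniformSpace.Completion.coe_sub, ← norm_eq_zero,
    UniformSpace.Completion.norm_coe, ← h₂]
  exact norm_eq_zero.2 (sub_eq_zero.2 h₁)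

/-- An operator commuting with `Y` acts termwise on the eventual orbits. -/
noncomputable def map (C : Q →L[ℂ] Q) (hC : ∀ x, C (Y x) = Y (C x)) :
    EventualOrbit Y →L[ℂ] EventualOrbit Y :=
  LinearMap.mkContinuous
    { toFun := fun s => ⟨fun n => C (s n), s.2.mono fun n h => (congrArg C h).trans (hC _)⟩
      map_add' := fun s t => Subtype.ext (funext fun n => map_add C (s n) (t n))
      map_smul' := fun c s => Subtype.ext (funext fun n => map_smul C c (s n)) }
    ‖C‖ (fun s => by
      obtain ⟨n, h₁, h₂⟩ := ((eventually_norm_eq s).and (eventually_norm_eq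
        (⟨fun n => C (s n), s.2.mono fun n h => (congrArg C h).trans (hC _)⟩ : EventualOrbit Y))).exists
      refine h₂.ge.trans ?_
      rw [← h₁]
      exact C.le_opNorm _)

theorem map_apply (C : Q →L[ℂ] Q) (hC : ∀ x, C (Y x) = Y (C x)) (s : EventualOrbit Y) (n : ℕ) :
    map C hC s n = C (s n) := rfl

theorem norm_map_apply {C : Q →L[ℂ] Q} (hC : ∀ x, C (Y x) = Y (C x)) (hn : ∀ x, ‖C x‖ = ‖x‖)
    (s : EventualOrbit Y) : ‖map C hC s‖ = ‖s‖ := by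
  obtain ⟨n, h₁, h₂⟩ := ((eventually_norm_eq s).and (eventually_norm_eq (map C hC s))).exists
  rw [← h₁, ← h₂, map_apply, hn]

/-- The orbit of `q` under `Y`, delayed by `N` steps. The first `N` terms, which do not matter, are
equal to `q` because `n - N = 0` there. -/
def delayed (Y : Q →ₗᵢ[ℂ] Q) (N : ℕ) (q : Q) : EventualOrbit Y :=
  ⟨fun n => (Y ^ (n - N)) q, by
    filter_upwards [Filter.eventually_ge_atTop N] with n hn
    rw [Nat.succ_sub hn, pow_succ']
    rfl⟩

theorem delayed_apply (N : ℕ) (q : Q) (n : ℕ) : delayed Y N q n = (Y ^ (n - N)) q := rfl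

theorem map_delayed {C : Q →L[ℂ] Q} (hC : ∀ x, C (Y x) = Y (C x)) (N : ℕ) (q : Q) :
    map C hC (delayed Y N q) = delayed Y N (C q) := by
  have h : ∀ m, C ((Y ^ m) q) = (Y ^ m) (C q) := fun m => by
    induction m with
    | zero => rfl
    | succ m ih =>
      rw [pow_succ']
      exact (hC _).trans (congrArg Y ih)
  exact Subtype.ext (funext fun n => h _)

/-- In the direct limit, delaying by one step inverts `Y`. -/
theorem coe_delayed_succ (N : ℕ) (q : Q) :
    (delayed Y (N + 1) (Y q) : UniformSpace.Completion (EventualOrbit Y)) = delayed Y N q := by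
  refine coe_eq_of_eventually_eq ?_
  filter_upwards [Filter.eventually_ge_atTop (N + 1)] with n hn
  rw [delayed_apply, delayed_apply, show n - N = n - (N + 1) + 1 by omega, pow_succ]
  rfl

/-- Every eventual orbit is represented by a delayed orbit. -/
theorem exists_coe_eq_delayed (s : EventualOrbit Y) :
    ∃ N, (s : UniformSpace.Completion (EventualOrbit Y)) = delayed Y N (s N) := by
  obtain ⟨N, hN⟩ := exists_tail s
  refine ⟨N, coe_eq_of_eventually_eq ?_⟩
  filter_upwards [Filter.eventually_ge_atTop N] with n hn
  exact hN n hn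

theorem norm_delayed_zero (q : Q) : ‖delayed Y 0 q‖ = ‖q‖ := by
  obtain ⟨n, h⟩ := (eventually_norm_eq (delayed Y 0 q)).exists
  exact h.symm.trans ((Y ^ n).norm_map q)

/-- The isometric embedding of `Q` that sends a vector to its orbit. -/
noncomputable def embed (Y : Q →ₗᵢ[ℂ] Q) : Q →ₗᵢ[ℂ] UniformSpace.Completion (EventualOrbit Y) where
  toFun q := (delayed Y 0 q : EventualOrbit Y)
  map_add' p q := by
    rw [← UniformSpace.Completion.coe_add]
    exact congrArg _ (Subtype.ext (funext fun n => map_add (Y ^ n) p q))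
  map_smul' c q := by
    rw [← UniformSpace.Completion.coe_smul]
    exact congrArg _ (Subtype.ext (funext fun n => map_smul (Y ^ n) c q))
  norm_map' q := (UniformSpace.Completion.norm_coe _).trans (norm_delayed_zero q)

theorem embed_apply (q : Q) : embed Y q = (delayed Y 0 q : EventualOrbit Y) := rfl

end EventualOrbit

theorem mem_unitary_of_isometry_of_denseRange {R : Type*} [NormedAddCommGroup R]
    [InnerProductSpace ℂ R] [CompleteSpace R] {U : R →L[ℂ] R} (hU : ∀ x, ‖U x‖ = ‖x‖)
    (hd : DenseRange U) : U ∈ unitary (R →L[ℂ] R) := by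
  have h₁ : (U†) * U = 1 := (ContinuousLinearMap.norm_map_iff_adjoint_comp_self U).1 hU
  refine Unitary.mem_iff.2 ⟨h₁, ?_⟩
  refine DFunLike.coe_injective (hd.equalizer (map_continuous _) (map_continuous _) ?_)
  funext x
  exact congrArg (fun A : R →L[ℂ] R => U (A x)) h₁

open EventualOrbit in
/-- Commuting isometries `X_j^*` extend to commuting unitaries `W_j^*`, and the extension is minimal
for the product. -/
theorem exists_unitary_extension {Q : Type u} [NormedAddCommGroup Q] [InnerProductSpace ℂ Q]
    [CompleteSpace Q] {d : ℕ} (X : Fin d → Q →L[ℂ] Q) (hX : ∀ i j, Commute (X i) (X j))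
    (hiso : ∀ j x, ‖((X j)†) x‖ = ‖x‖) :
    ∃ (R : Type u) (_ : NormedAddCommGroup R) (_ : InnerProductSpace ℂ R) (_ : CompleteSpace R)
      (ι : Q →ₗᵢ[ℂ] R) (W : Fin d → R →L[ℂ] R),
      (∀ j, W j ∈ unitary (R →L[ℂ] R)) ∧ (∀ i j, Commute (W i) (W j)) ∧
      (∀ j x, ((W j)†) (ι x) = ι (((X j)†) x)) ∧
      (Submodule.span ℂ {x : R | ∃ (n : ℕ) (y : Q),
        x = (tupleProd W ^ n) (ι y)}).topologicalClosure = ⊤ := by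
  have hYn : ∀ x, ‖((tupleProd X)†) x‖ = ‖x‖ := tupleProd_mem
    { carrier := {A : Q →L[ℂ] Q | ∀ x, ‖(A†) x‖ = ‖x‖}
      one_mem' := fun x => by
        have h : (1 : Q →L[ℂ] Q)† = 1 := star_one _
        rw [h]
        rfl
      mul_mem' := fun {A B} hA hB x => by
        rw [adjoint_mul, mul_apply_eq_comp, hB, hA] } hiso
  let Y : Q →ₗᵢ[ℂ] Q := ⟨((tupleProd X)†).toLinearMap, hYn⟩
  have hC : ∀ i x, ((X i)†) (Y x) = Y (((X i)†) x) := fun i x =>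
    congrArg (fun A : Q →L[ℂ] Q => A x) (commute_adjoint (commute_tupleProd (hX i))).eq
  let U : Fin d → UniformSpace.Completion (EventualOrbit Y) →L[ℂ]
      UniformSpace.Completion (EventualOrbit Y) := fun i => (map ((X i)†) (hC i)).completion
  have hUcoe : ∀ i (s : EventualOrbit Y), U i s = (map ((X i)†) (hC i) s : EventualOrbit Y) :=
    fun i s => ContinuousLinearMap.completion_apply_coe _ s
  have hUn : ∀ i x, ‖U i x‖ = ‖x‖ := fun i x => by
    induction x using UniformSpace.Completion.induction_on with
    | hp => exact isClosed_eq (by fun_prop) (by fun_prop)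
    | ih s =>
      rw [hUcoe, UniformSpace.Completion.norm_coe, UniformSpace.Completion.norm_coe,
        norm_map_apply _ (hiso i)]
  have hUc : ∀ i j, Commute (U i) (U j) := fun i j => by
    refine ContinuousLinearMap.ext fun x => ?_
    induction x using UniformSpace.Completion.induction_on with
    | hp => exact isClosed_eq (by fun_prop) (by fun_prop)
    | ih s =>
      rw [mul_apply_eq_comp, mul_apply_eq_comp, hUcoe, hUcoe, hUcoe, hUcoe]
      refine congrArg _ (Subtype.ext (funext fun n => ?_))
      exact congrArg (fun A : Q →L[ℂ] Q => A (s n)) (commute_adjoint (hX i j)).eq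
  -- `U i` extends `X_i^*`, so the unitary tuple consists of the adjoints
  let W := fun i => (U i)†
  have hWU : ∀ i, (W i)† = U i := fun i => ContinuousLinearMap.adjoint_adjoint _
  have hWc : ∀ i j, Commute (W i) (W j) := fun i j => commute_adjoint (hUc i j)
  have hWD : ∀ N q, ((tupleProd W)†) (delayed Y (N + 1) q : EventualOrbit Y) =
      (delayed Y N q : EventualOrbit Y) := fun N q => by
    rw [adjoint_tupleProd_apply (T := X) (W := W)
      (J := fun q => ((delayed Y (N + 1) q : EventualOrbit Y) :
        UniformSpace.Completion (EventualOrbit Y)))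
      (fun i x => by rw [hWU, hUcoe, map_delayed]) q]
    exact coe_delayed_succ N q
  have hdense : DenseRange ((tupleProd W)†) :=
    UniformSpace.Completion.denseRange_coe.mono (by
      rintro _ ⟨s, rfl⟩
      obtain ⟨N, hN⟩ := exists_coe_eq_delayed s
      rw [hN]
      exact ⟨_, hWD N _⟩)
  -- the range of `U i` contains that of the adjoint of `tupleProd W`, which has `U i` as a factor
  have hU : ∀ i, U i ∈ unitary _ := fun i => by
    refine mem_unitary_of_isometry_of_denseRange (hUn i) (hdense.mono ?_)
    rintro _ ⟨x, rfl⟩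
    rw [← mul_omitProd hWc i, (commute_omitProd (hWc i) i).eq, adjoint_mul, hWU]
    exact ⟨_, rfl⟩
  have hW : ∀ i, W i ∈ unitary _ := fun i => Unitary.star_mem (hU i)
  have hWDu : tupleProd W ∈ unitary _ := tupleProd_mem _ hW
  have hpow : ∀ N q, ((delayed Y N q : EventualOrbit Y) : UniformSpace.Completion _) =
      (tupleProd W ^ N) (embed Y q) := fun N q => by
    induction N with
    | zero => rfl
    | succ N ih =>
      rw [pow_succ', mul_apply_eq_comp, ← ih, ← hWD N]
      exact (congrArg (fun A => A ((delayed Y (N + 1) q : EventualOrbit Y) :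
        UniformSpace.Completion (EventualOrbit Y))) (Unitary.mul_star_self_of_mem hWDu)).symm
  refine ⟨UniformSpace.Completion (EventualOrbit Y), inferInstance, inferInstance, inferInstance,
    embed Y, W, hW, hWc, fun j x => ?_, ?_⟩
  · rw [hWU, embed_apply, hUcoe, map_delayed]
    rfl
  · rw [← Submodule.dense_iff_topologicalClosure_eq_top]
    refine UniformSpace.Completion.denseRange_coe.mono ?_
    rintro _ ⟨s, rfl⟩
    obtain ⟨N, hN⟩ := exists_coe_eq_delayed s
    exact Submodule.subset_span ⟨N, s N, hN.trans (hpow N _)⟩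

end UnitaryExtension

/-! ### The canonical unitary tuple -/

section CanonicalTuple

theorem exists_canonicalUnitaryTuple {H : Type u} [NormedAddCommGroup H] [InnerProductSpace ℂ H]
    [CompleteSpace H] {d : ℕ} {T : Fin d → H →L[ℂ] H} (hcomm : ∀ i j, Commute (T i) (T j))
    (hT : ∀ j, ‖T j‖ ≤ 1) :
    ∃ (R : Type u) (_ : NormedAddCommGroup R) (_ : InnerProductSpace ℂ R) (_ : CompleteSpace R)
      (ι : asymptoticSpace (tupleProd T) →ₗᵢ[ℂ] R) (W : Fin d → R →L[ℂ] R),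
      IsCanonicalUnitaryTuple T ι W := by
  set P := tupleProd T with hP
  have hPn : ‖P‖ ≤ 1 := norm_tupleProd_le hT
  have hTP : ∀ j, Commute (T j) P := fun j => commute_tupleProd (hcomm j)
  -- `‖Q h‖ = ‖Q T^* h‖ = ‖Q T_(j)^* T_j^* h‖ ≤ ‖Q T_j^* h‖ ≤ ‖Q h‖`
  have hQ : ∀ j h, ‖asymptoticRootTo P (((T j)†) h)‖ = ‖asymptoticRootTo P h‖ := fun j h => by
    refine (norm_asymptoticRootTo_le hPn (hT j) (hTP j) h).antisymm ?_
    have hO : Commute (omitProd T j) P :=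
      commute_tupleProd fun i => (commute_omitProd (hcomm i) j).symm
    have h₁ : (P†) h = ((omitProd T j)†) (((T j)†) h) := by
      rw [hP, ← mul_omitProd hcomm j, adjoint_mul, mul_apply_eq_comp]
    rw [← norm_asymptoticRootTo_adjoint hPn, h₁]
    exact norm_asymptoticRootTo_le hPn (norm_omitProd_le hT j) hO _
  have hd := denseRange_asymptoticRootTo P
  choose C _ hC using fun j => exists_factor (asymptoticRootTo P)
    (asymptoticRootTo P ∘L ((T j)†)) hd fun h => (hQ j h).le
  simp only [ContinuousLinearMap.comp_apply] at hC
  have hCn : ∀ j y, ‖C j y‖ = ‖y‖ := fun j y => by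
    refine hd.induction_on (p := fun y => ‖C j y‖ = ‖y‖) y
      (isClosed_eq (by fun_prop) (by fun_prop)) fun h => ?_
    rw [hC, hQ]
  have hCc : ∀ i j, Commute (C i) (C j) := fun i j => by
    refine DFunLike.coe_injective
      (hd.equalizer (map_continuous (C i * C j)) (map_continuous (C j * C i)) ?_)
    funext h
    simp only [Function.comp_apply, mul_apply_eq_comp, hC]
    exact congrArg (fun A : H →L[ℂ] H => asymptoticRootTo P (A h)) (commute_adjoint (hcomm i j)).eq
  obtain ⟨R, _, _, _, ι, W, h₁, h₂, h₃, h₄⟩ := exists_unitary_extension (fun j => (C j)†)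
    (fun i j => commute_adjoint (hCc i j))
    (fun j y => by rw [ContinuousLinearMap.adjoint_adjoint, hCn])
  refine ⟨R, inferInstance, inferInstance, inferInstance, ι, W, h₁, h₂, fun j h => ?_, h₄⟩
  rw [h₃, ContinuousLinearMap.adjoint_adjoint, hC]

end CanonicalTuple

/-! ### The Douglas model -/

section Douglas

variable {H : Type*} [NormedAddCommGroup H] [InnerProductSpace ℂ H] [CompleteSpace H]
variable {R : Type*} [NormedAddCommGroup R] [InnerProductSpace ℂ R]
variable {T : H →L[ℂ] H}

/-- The sum telescopes: `‖D_{T^*} T^{*n} h‖² = ‖T^{*n} h‖² - ‖T^{*(n+1)} h‖²`. -/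
theorem hasSum_norm_defectAdjTo_sq (hT : ‖T‖ ≤ 1) (h : H) :
    HasSum (fun n : ℕ => ‖defectAdjTo T (((T†) ^ n) h)‖ ^ 2)
      (‖h‖ ^ 2 - ‖asymptoticRoot T h‖ ^ 2) := by
  rw [hasSum_iff_tendsto_nat_of_nonneg fun n => by positivity]
  have hs : ∀ N, ∑ n ∈ Finset.range N, ‖defectAdjTo T (((T†) ^ n) h)‖ ^ 2 =
      ‖h‖ ^ 2 - ‖((T†) ^ N) h‖ ^ 2 := fun N => by
    induction N with
    | zero => simp
    | succ N ih =>
      rw [Finset.sum_range_succ, ih, norm_defectAdjTo, norm_defectAdj_sq hT, pow_succ' (T†) N,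
        mul_apply_eq_comp]
      ring
  simp only [hs]
  exact (tendsto_norm_adjoint_pow_sq hT h).const_sub _

/-- The Hardy space component `h ↦ ∑ zⁿ D_{T^*} T^{*n} h` of the Douglas embedding. -/
noncomputable def douglasHardy (hT : ‖T‖ ≤ 1) : H →ₗ[ℂ] Hardy (defectSpaceAdj T) where
  toFun h := ⟨fun n => defectAdjTo T (((T†) ^ n) h),
    memHardy_of_summable (hasSum_norm_defectAdjTo_sq hT h).summable⟩
  map_add' x y := lp.ext (funext fun n => (defectAdjTo T ∘L ((T†) ^ n)).map_add x y)
  map_smul' c x := lp.ext (funext fun n => (defectAdjTo T ∘L ((T†) ^ n)).map_smul c x)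

theorem norm_douglasHardy_sq (hT : ‖T‖ ≤ 1) (h : H) :
    ‖douglasHardy hT h‖ ^ 2 = ‖h‖ ^ 2 - ‖asymptoticRoot T h‖ ^ 2 :=
  (Hardy.hasSum_norm_sq _).unique (hasSum_norm_defectAdjTo_sq hT h)

/-- The Douglas embedding `h ↦ (∑ zⁿ D_{T^*} T^{*n} h) ⊕ Q h`. -/
noncomputable def douglasEmbedding (hT : ‖T‖ ≤ 1) (ι : asymptoticSpace T →ₗᵢ[ℂ] R) :
    H →ₗᵢ[ℂ] WithLp 2 (Hardy (defectSpaceAdj T) × R) where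
  toFun h := WithLp.toLp 2 (douglasHardy hT h, ι (asymptoticRootTo T h))
  map_add' x y := by
    rw [map_add, map_add, map_add]
    rfl
  map_smul' c x := by
    rw [map_smul, map_smul, map_smul]
    rfl
  norm_map' h := by
    refine (sq_eq_sq₀ (norm_nonneg _) (norm_nonneg _)).1 ?_
    refine (WithLp.prod_norm_sq_eq_of_L2 _).trans ?_
    refine (congrArg₂ (· + ·) (norm_douglasHardy_sq hT h)
      (congrArg (· ^ 2) (ι.norm_map (asymptoticRootTo T h)))).trans ?_
    exact sub_add_cancel _ _

theorem douglasEmbedding_fst (hT : ‖T‖ ≤ 1) (ι : asymptoticSpace T →ₗᵢ[ℂ] R) (h : H) (n : ℕ) :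
    (douglasEmbedding hT ι h).fst n = defectAdjTo T (((T†) ^ n) h) := rfl

theorem douglasEmbedding_snd (hT : ‖T‖ ≤ 1) (ι : asymptoticSpace T →ₗᵢ[ℂ] R) (h : H) :
    (douglasEmbedding hT ι h).snd = ι (asymptoticRootTo T h) := rfl

theorem prod_ext {E F : Type*} {x y : WithLp 2 (E × F)} (h₁ : x.fst = y.fst)
    (h₂ : x.snd = y.snd) : x = y :=
  WithLp.ofLp_injective 2 (Prod.ext h₁ h₂)

variable [CompleteSpace R]

/-- The coefficients of `M_{G₁^* + zG₂}^* Π h` are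
`G₁ D_{T^*} T^{*n} h + G₂^* D_{T^*} T^{*(n+1)} h = D_{T^*} A^* T^{*n} h`. -/
theorem adjoint_directSum_douglasEmbedding (hT : ‖T‖ ≤ 1) (ι : asymptoticSpace T →ₗᵢ[ℂ] R)
    {A : H →L[ℂ] H} (hA : Commute A T) {G₁ G₂ : defectSpaceAdj T →L[ℂ] defectSpaceAdj T}
    (hG : ∀ h, G₁ (defectAdjTo T h) + (G₂†) (defectAdjTo T ((T†) h)) = defectAdjTo T ((A†) h))
    {W : R →L[ℂ] R}
    (hW : ∀ h, (W†) (ι (asymptoticRootTo T h)) = ι (asymptoticRootTo T ((A†) h))) (h : H) :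
    ((directSum (mulPencil (G₁†) G₂) W)†) (douglasEmbedding hT ι h) =
      douglasEmbedding hT ι ((A†) h) := by
  rw [adjoint_directSum]
  refine prod_ext ?_ (hW h)
  refine lp.ext (funext fun n => ?_)
  have hc : ((T†) ^ n) ((A†) h) = (A†) (((T†) ^ n) h) :=
    congrArg (fun C : H →L[ℂ] H => C h) ((commute_adjoint hA).pow_right n).eq.symm
  rw [directSum_fst]
  refine (adjoint_mulPencil_apply _ _ _ n).trans ?_
  rw [ContinuousLinearMap.adjoint_adjoint, douglasEmbedding_fst, douglasEmbedding_fst,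
    douglasEmbedding_fst, pow_succ', mul_apply_eq_comp, hc, hG]

/-- `Vⁿ (Π h - V Π T^* h) = zⁿ D_{T^*} h ⊕ 0`. -/
theorem directSum_mulZ_pow_sub (hT : ‖T‖ ≤ 1) (ι : asymptoticSpace T →ₗᵢ[ℂ] R) {W : R →L[ℂ] R}
    (hWu : W ∈ unitary (R →L[ℂ] R))
    (hW : ∀ h, (W†) (ι (asymptoticRootTo T h)) = ι (asymptoticRootTo T ((T†) h))) (n : ℕ) (h : H) :
    (directSum mulZ W ^ n) (douglasEmbedding hT ι h) -
      (directSum mulZ W ^ (n + 1)) (douglasEmbedding hT ι ((T†) h)) =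
    WithLp.toLp 2 ((lp.single 2 n (defectAdjTo T h) : Hardy (defectSpaceAdj T)), (0 : R)) := by
  have h₀ : douglasEmbedding hT ι h - directSum mulZ W (douglasEmbedding hT ι ((T†) h)) =
      WithLp.toLp 2 ((lp.single 2 0 (defectAdjTo T h) : Hardy (defectSpaceAdj T)), (0 : R)) := by
    refine prod_ext ?_ ?_
    · refine lp.ext (funext fun m => ?_)
      change (douglasEmbedding hT ι h).fst m -
        shiftCoeff (fun k => (douglasEmbedding hT ι ((T†) h)).fst k) m = _
      cases m with
      | zero => simp [shiftCoeff, douglasEmbedding_fst]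
      | succ m =>
        rw [shiftCoeff, douglasEmbedding_fst, douglasEmbedding_fst, pow_succ, mul_apply_eq_comp,
          sub_self]
        exact (lp.single_apply_ne (E := fun _ : ℕ => defectSpaceAdj T) 2 0 _
          (Nat.succ_ne_zero m)).symm
    · change ι (asymptoticRootTo T h) - W (ι (asymptoticRootTo T ((T†) h))) = 0
      rw [← hW, sub_eq_zero]
      exact (congrArg (fun C : R →L[ℂ] R => C (ι (asymptoticRootTo T h)))
        (Unitary.mul_star_self_of_mem hWu)).symm
  rw [pow_succ, mul_apply_eq_comp, ← map_sub, h₀, directSum_pow]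
  refine prod_ext ?_ ?_
  · exact mulZ_pow_single n _
  · exact map_zero (W ^ n)

theorem eq_zero_of_forall_inner_eq_zero {F : Type*} {E : Type*} [NormedAddCommGroup E]
    [InnerProductSpace ℂ E] {f : F → E} (hf : DenseRange f) {x : E}
    (h : ∀ y, inner ℂ (f y) x = 0) : x = 0 := by
  refine inner_self_eq_zero (𝕜 := ℂ).1 ?_
  exact hf.induction_on (p := fun y => inner ℂ y x = 0) x
    (isClosed_eq (by fun_prop) (by fun_prop)) h

theorem norm_apply_of_mem_unitary {U : R →L[ℂ] R} (hU : U ∈ unitary (R →L[ℂ] R)) (x : R) :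
    ‖U x‖ = ‖x‖ :=
  (ContinuousLinearMap.norm_map_iff_adjoint_comp_self U).2 (Unitary.star_mul_self_of_mem hU) x

theorem isMinimalIsometricLift_douglas (hT : ‖T‖ ≤ 1) (ι : asymptoticSpace T →ₗᵢ[ℂ] R)
    {W : R →L[ℂ] R} (hWu : W ∈ unitary (R →L[ℂ] R))
    (hW : ∀ h, (W†) (ι (asymptoticRootTo T h)) = ι (asymptoticRootTo T ((T†) h)))
    (hmin : (Submodule.span ℂ {x : R | ∃ (n : ℕ) (y : asymptoticSpace T),
      x = (W ^ n) (ι y)}).topologicalClosure = ⊤) :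
    IsMinimalIsometricLift T (douglasEmbedding hT ι) (directSum mulZ W) where
  isometry := by
    refine AddMonoidHomClass.isometry_of_norm _ fun x => ?_
    refine (sq_eq_sq₀ (norm_nonneg _) (norm_nonneg _)).1 ?_
    rw [directSum_norm_sq_apply, norm_mulZ_apply, norm_apply_of_mem_unitary hWu,
      WithLp.prod_norm_sq_eq_of_L2]
  lift h := by
    rw [adjoint_directSum]
    refine prod_ext (lp.ext (funext fun n => ?_)) (hW h)
    exact adjoint_mulZ_apply _ n
  minimal := by
    rw [Submodule.topologicalClosure_eq_top_iff, Submodule.eq_bot_iff]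
    intro x hx
    have hx' : ∀ n h, inner ℂ ((directSum mulZ W ^ n) (douglasEmbedding hT ι h)) x = 0 :=
      fun n h => hx _ (Submodule.subset_span ⟨n, h, rfl⟩)
    -- `x` is orthogonal to `zⁿ D_{T^*} h ⊕ 0`, a difference of two of the spanning vectors
    have h₁ : x.fst = 0 := by
      refine lp.ext (funext fun n => ?_)
      refine eq_zero_of_forall_inner_eq_zero (denseRange_defectAdjTo T) fun h => ?_
      have h₀ := congrArg₂ (· - ·) (hx' n h) (hx' (n + 1) ((T†) h))
      simp only [← inner_sub_left, directSum_mulZ_pow_sub hT ι hWu hW, sub_zero] at h₀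
      rw [WithLp.prod_inner_apply, inner_zero_left, add_zero] at h₀
      exact (inner_single_left n _ _).symm.trans h₀
    have h₂ : ∀ n y, inner ℂ ((W ^ n) (ι y)) x.snd = 0 := fun n y => by
      refine (denseRange_asymptoticRootTo T).induction_on
        (p := fun y => inner ℂ ((W ^ n) (ι y)) x.snd = 0) y
        (isClosed_eq (by fun_prop) (by fun_prop)) fun h => ?_
      have := hx' n h
      rw [directSum_pow, WithLp.prod_inner_apply] at this
      change inner ℂ _ x.fst + inner ℂ ((W ^ n) (ι (asymptoticRootTo T h))) x.snd = 0 at this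
      rwa [h₁, inner_zero_right, zero_add] at this
    refine prod_ext h₁ ?_
    rw [Submodule.topologicalClosure_eq_top_iff] at hmin
    refine (Submodule.mem_bot ℂ).1 (hmin ▸ ?_)
    rw [Submodule.mem_orthogonal]
    intro u hu
    induction hu using Submodule.span_induction with
    | mem u hu =>
      obtain ⟨n, y, rfl⟩ := hu
      exact h₂ n y
    | zero => exact inner_zero_left _
    | add u v _ _ hu hv => rw [inner_add_left, hu, hv, add_zero]
    | smul c u _ hu => rw [inner_smul_left, hu, mul_zero]

theorem isPseudoCommutativeContractiveLift_douglas {d : ℕ} {T : Fin d → H →L[ℂ] H}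
    (hcomm : ∀ i j, Commute (T i) (T j)) (hT : ‖tupleProd T‖ ≤ 1)
    {G₁ G₂ : Fin d → defectSpaceAdj (tupleProd T) →L[ℂ] defectSpaceAdj (tupleProd T)}
    (hG : IsFundamentalAdj T G₁ G₂) {ι : asymptoticSpace (tupleProd T) →ₗᵢ[ℂ] R}
    {W : Fin d → R →L[ℂ] R} (hW : IsCanonicalUnitaryTuple T ι W) :
    IsPseudoCommutativeContractiveLift T (douglasEmbedding hT ι)
      (fun j => directSum (mulPencil ((G₁ j)†) (G₂ j)) (W j))
      (directSum mulZ (tupleProd W)) := by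
  have hTj : ∀ j, Commute (T j) (tupleProd T) := fun j => commute_tupleProd (hcomm j)
  have hOj : ∀ j, Commute (omitProd T j) (tupleProd T) := fun j =>
    commute_tupleProd fun i => (commute_omitProd (hcomm i) j).symm
  have hWO : ∀ j, ((W j)†) * tupleProd W = omitProd W j := fun j => by
    have h : ((W j)†) * W j = 1 := Unitary.star_mul_self_of_mem (hW.unitary j)
    rw [← mul_omitProd hW.commute j, ← mul_assoc, h, one_mul]
  have hS : ∀ j, ((directSum (mulPencil ((G₁ j)†) (G₂ j)) (W j))†) *
      directSum mulZ (tupleProd W) =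
      directSum (mulPencil ((G₂ j)†) (G₁ j)) (omitProd W j) := fun j => by
    rw [adjoint_directSum, directSum_mul, adjoint_mulPencil_mul_mulZ,
      ContinuousLinearMap.adjoint_adjoint, hWO]
  have hJ : ∀ i h, ((W i)†) ((ι ∘ asymptoticRootTo (tupleProd T)) h) =
      (ι ∘ asymptoticRootTo (tupleProd T)) (((T i)†) h) := hW.extends_adjoint
  refine ⟨isMinimalIsometricLift_douglas hT ι (tupleProd_mem _ hW.unitary)
    (adjoint_tupleProd_apply hJ) hW.minimal, fun j => ?_, fun j => ?_, fun j h => ?_, fun j h => ?_⟩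
  · exact commute_directSum (commute_mulPencil_mulZ _ _) (commute_tupleProd (hW.commute j))
  · rw [hS]
    exact commute_directSum (commute_mulPencil_mulZ _ _)
      (commute_tupleProd fun i => (commute_omitProd (hW.commute i) j).symm)
  · exact adjoint_directSum_douglasEmbedding hT ι (hTj j) (fundamental_add_adjoint hT (hTj j)
      (fun h => (hG j h).1) (fun h => (hG j h).2)) (hJ j) h
  · rw [hS]
    exact adjoint_directSum_douglasEmbedding hT ι (hOj j) (fundamental_add_adjoint hT (hOj j)
      (fun h => (hG j h).2) (fun h => (hG j h).1)) (adjoint_omitProd_apply hJ j) h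

end Douglas

/-! ### Uniqueness of lifts -/

section Uniqueness

variable {H : Type*} [NormedAddCommGroup H] [InnerProductSpace ℂ H] [CompleteSpace H]
variable {K : Type*} [NormedAddCommGroup K] [InnerProductSpace ℂ K] [CompleteSpace K]
variable {K' : Type*} [NormedAddCommGroup K'] [InnerProductSpace ℂ K'] [CompleteSpace K']
variable {T : H →L[ℂ] H} {P : H →ₗᵢ[ℂ] K} {V : K →L[ℂ] K} {P' : H →ₗᵢ[ℂ] K'} {V' : K' →L[ℂ] K'}

namespace IsMinimalIsometricLift

theorem inner_pow_apply_left (hV : IsMinimalIsometricLift T P V) (n : ℕ) (h k : H) :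
    inner ℂ ((V ^ n) (P h)) (P k) = inner ℂ h (((T†) ^ n) k) := by
  induction n generalizing k with
  | zero => exact P.inner_map_map h k
  | succ n ih =>
    rw [pow_succ', mul_apply_eq_comp, ← ContinuousLinearMap.adjoint_inner_right, hV.lift, ih,
      pow_succ, mul_apply_eq_comp]

theorem inner_pow_apply_pow_apply (hV : IsMinimalIsometricLift T P V) (n m : ℕ) (x y : K) :
    inner ℂ ((V ^ (n + m)) x) ((V ^ m) y) = inner ℂ ((V ^ n) x) y := by
  let V₀ : K →ₗᵢ[ℂ] K := V.toLinearMap.toLinearIsometry hV.isometry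
  induction m with
  | zero => rfl
  | succ m ih =>
    rw [← add_assoc, pow_succ', pow_succ' V m, mul_apply_eq_comp, mul_apply_eq_comp]
    exact (V₀.inner_map_map _ _).trans ih

/-- The Gram matrix of the vectors `Vⁿ Π h` depends on `T` only. -/
theorem inner_pow_eq (hV : IsMinimalIsometricLift T P V) (hV' : IsMinimalIsometricLift T P' V')
    (n m : ℕ) (h k : H) :
    inner ℂ ((V ^ n) (P h)) ((V ^ m) (P k)) = inner ℂ ((V' ^ n) (P' h)) ((V' ^ m) (P' k)) := by
  rcases le_total m n with hmn | hmn
  · obtain ⟨c, rfl⟩ := Nat.exists_eq_add_of_le' hmn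
    rw [hV.inner_pow_apply_pow_apply, hV'.inner_pow_apply_pow_apply, hV.inner_pow_apply_left,
      hV'.inner_pow_apply_left]
  · obtain ⟨c, rfl⟩ := Nat.exists_eq_add_of_le' hmn
    rw [← inner_conj_symm, hV.inner_pow_apply_pow_apply, hV.inner_pow_apply_left,
      ← inner_conj_symm ((V' ^ n) (P' h)), hV'.inner_pow_apply_pow_apply,
      hV'.inner_pow_apply_left]

theorem dense_span (hV : IsMinimalIsometricLift T P V) :
    Dense (Submodule.span ℂ {x : K | ∃ (n : ℕ) (h : H), x = (V ^ n) (P h)} : Set K) :=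
  Submodule.dense_iff_topologicalClosure_eq_top.2 hV.minimal

theorem eq_of_forall_inner_eq (hV : IsMinimalIsometricLift T P V) {x y : K}
    (h : ∀ n k, inner ℂ ((V ^ n) (P k)) x = inner ℂ ((V ^ n) (P k)) y) : x = y := by
  have h₀ : innerSL ℂ x = innerSL ℂ y := ContinuousLinearMap.ext_on hV.dense_span (by
    rintro _ ⟨n, k, rfl⟩
    rw [innerSL_apply_apply, innerSL_apply_apply, ← inner_conj_symm, h, inner_conj_symm])
  exact ext_inner_right ℂ fun z => congrArg (fun f : K →L[ℂ] ℂ => f z) h₀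

/-- The map `∑ xₙ ↦ ∑ Vⁿ Π xₙ` on finitely supported sequences in `H`. -/
noncomputable def orbitSum (P : H →ₗᵢ[ℂ] K) (V : K →L[ℂ] K) : (ℕ →₀ H) →ₗ[ℂ] K :=
  Finsupp.lsum ℂ fun n => (V ^ n).toLinearMap ∘ₗ P.toLinearMap

omit [CompleteSpace H] [CompleteSpace K] in
theorem orbitSum_single (n : ℕ) (h : H) : orbitSum P V (Finsupp.single n h) = (V ^ n) (P h) :=
  Finsupp.lsum_single ℂ (fun n => (V ^ n).toLinearMap ∘ₗ P.toLinearMap) n h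

omit [CompleteSpace H] [CompleteSpace K] in
theorem orbitSum_apply (x : ℕ →₀ H) : orbitSum P V x = x.sum fun n h => (V ^ n) (P h) :=
  rfl

theorem denseRange_orbitSum (hV : IsMinimalIsometricLift T P V) : DenseRange (orbitSum P V) := by
  refine hV.dense_span.mono ?_
  rw [← LinearMap.coe_range]
  refine Submodule.span_le.2 ?_
  rintro _ ⟨n, h, rfl⟩
  exact ⟨Finsupp.single n h, orbitSum_single n h⟩

theorem norm_orbitSum_eq (hV : IsMinimalIsometricLift T P V)
    (hV' : IsMinimalIsometricLift T P' V') (x : ℕ →₀ H) :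
    ‖orbitSum P' V' x‖ = ‖orbitSum P V x‖ := by
  rw [norm_eq_sqrt_re_inner (𝕜 := ℂ), norm_eq_sqrt_re_inner (𝕜 := ℂ) (orbitSum P V x)]
  simp only [orbitSum_apply, Finsupp.sum, sum_inner, inner_sum, hV.inner_pow_eq hV']

/-- The minimal isometric lift is unique up to a unitary. -/
theorem exists_unitary (hV : IsMinimalIsometricLift T P V)
    (hV' : IsMinimalIsometricLift T P' V') :
    ∃ τ : K ≃ₗᵢ[ℂ] K', ∀ n h, τ ((V ^ n) (P h)) = (V' ^ n) (P' h) := by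
  refine ⟨(LinearEquiv.refl ℂ (ℕ →₀ H)).extendOfIsometry (orbitSum P V) (orbitSum P' V')
    hV.denseRange_orbitSum hV'.denseRange_orbitSum (hV.norm_orbitSum_eq hV'), fun n h => ?_⟩
  rw [← orbitSum_single, ← orbitSum_single (P := P')]
  exact LinearEquiv.extendOfIsometry_eq (LinearEquiv.refl ℂ (ℕ →₀ H)) _ _
    hV.denseRange_orbitSum hV'.denseRange_orbitSum (hV.norm_orbitSum_eq hV') _

end IsMinimalIsometricLift

namespace IsPseudoCommutativeContractiveLift

variable {d : ℕ} {T : Fin d → H →L[ℂ] H} {S : Fin d → K →L[ℂ] K} {S' : Fin d → K' →L[ℂ] K'}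

/-- Since `S_j^* Π = Π T_j^*`, the compression of `S_j` to `Π H` is `T_j`. -/
theorem inner_apply_zero (hS : IsPseudoCommutativeContractiveLift T P S V) (j : Fin d) (h k : H) :
    inner ℂ (P k) (S j (P h)) = inner ℂ (((T j)†) k) h := by
  rw [← ContinuousLinearMap.adjoint_inner_left, hS.lift, P.inner_map_map]

/-- Since `V^* S_j = (S_j^* V)^*`, the vector `V^* S_j Π h` is `Π T_(j)^* h`. -/
theorem inner_apply_succ (hS : IsPseudoCommutativeContractiveLift T P S V) (j : Fin d) (n : ℕ)
    (h k : H) :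
    inner ℂ ((V ^ (n + 1)) (P k)) (S j (P h)) =
      inner ℂ k ((((tupleProd T)†) ^ n) (((omitProd T j)†) h)) := by
  have h₁ : (V†) (S j (P h)) = P (((omitProd T j)†) h) := by
    rw [← hS.lift', adjoint_mul, ContinuousLinearMap.adjoint_adjoint, mul_apply_eq_comp]
  rw [pow_succ', mul_apply_eq_comp, ← ContinuousLinearMap.adjoint_inner_right, h₁,
    hS.minimalLift.inner_pow_apply_left]

theorem unitarilyEquivalent (hS : IsPseudoCommutativeContractiveLift T P S V)
    (hS' : IsPseudoCommutativeContractiveLift T P' S' V') :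
    UnitarilyEquivalent P S V P' S' V' := by
  obtain ⟨τ, hτ⟩ := hS.minimalLift.exists_unitary hS'.minimalLift
  have hP : ∀ h, τ (P h) = P' h := hτ 0
  let τ₀ : K →L[ℂ] K' := τ.toContinuousLinearEquiv.toContinuousLinearMap
  have hVτ : ∀ x, τ (V x) = V' (τ x) := by
    have h₀ : τ₀ ∘L V = V' ∘L τ₀ := by
      refine ContinuousLinearMap.ext_on hS.minimalLift.dense_span ?_
      rintro _ ⟨n, h, rfl⟩
      change τ (V ((V ^ n) (P h))) = V' (τ ((V ^ n) (P h)))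
      rw [hτ, ← mul_apply_eq_comp, ← pow_succ', hτ, pow_succ', mul_apply_eq_comp]
    exact fun x => congrArg (fun A : K →L[ℂ] K' => A x) h₀
  have hVnτ : ∀ n x, τ ((V ^ n) x) = (V' ^ n) (τ x) := fun n x => by
    induction n with
    | zero => rfl
    | succ n ih => rw [pow_succ', pow_succ', mul_apply_eq_comp, mul_apply_eq_comp, hVτ, ih]
  -- the inner products of `S_j Π h` with the total set of vectors `Vⁿ Π k` are determined by `T`
  have hSP : ∀ j h, τ (S j (P h)) = S' j (P' h) := fun j h => by
    refine hS'.minimalLift.eq_of_forall_inner_eq fun n k => ?_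
    rw [← hτ, τ.inner_map_map, hτ]
    cases n with
    | zero => exact (hS.inner_apply_zero j h k).trans (hS'.inner_apply_zero j h k).symm
    | succ n => rw [hS.inner_apply_succ, hS'.inner_apply_succ]
  refine ⟨τ, fun j => ?_, hVτ, hP⟩
  have h₀ : τ₀ ∘L S j = S' j ∘L τ₀ := by
    refine ContinuousLinearMap.ext_on hS.minimalLift.dense_span ?_
    rintro _ ⟨n, h, rfl⟩
    change τ (S j ((V ^ n) (P h))) = S' j (τ ((V ^ n) (P h)))
    have h₁ : S j ((V ^ n) (P h)) = (V ^ n) (S j (P h)) :=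
      congrArg (fun A : K →L[ℂ] K => A (P h)) ((hS.commute j).pow_right n).eq
    have h₂ : S' j ((V' ^ n) (P' h)) = (V' ^ n) (S' j (P' h)) :=
      congrArg (fun A : K' →L[ℂ] K' => A (P' h)) ((hS'.commute j).pow_right n).eq
    rw [h₁, hVnτ, hSP, hτ, h₂]
  exact fun x => congrArg (fun A : K →L[ℂ] K' => A x) h₀

end IsPseudoCommutativeContractiveLift

end Uniqueness

/-! ### Existence of fundamental operators and of lifts -/

section Existence

variable {H : Type*} [NormedAddCommGroup H] [InnerProductSpace ℂ H] [CompleteSpace H]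
variable {d : ℕ} {T : Fin d → H →L[ℂ] H}

theorem exists_isFundamentalAdj (hcomm : ∀ i j, Commute (T i) (T j)) (hT : ∀ j, ‖T j‖ ≤ 1) :
    ∃ G₁ G₂ : Fin d → defectSpaceAdj (tupleProd T) →L[ℂ] defectSpaceAdj (tupleProd T),
      IsFundamentalAdj T G₁ G₂ ∧ ∀ j, ‖mulPencil ((G₁ j)†) (G₂ j)‖ ≤ 1 := by
  choose G₁ G₂ h₁ h₂ h₃ using fun j => exists_fundamental_pair (hT j) (norm_omitProd_le hT j)
    (mul_omitProd hcomm j) ((commute_omitProd (hcomm j) j).eq.symm.trans (mul_omitProd hcomm j))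
  exact ⟨G₁, G₂, fun j h => ⟨h₁ j h, h₂ j h⟩, h₃⟩

theorem IsFundamentalAdj.unique
    {G₁ G₂ G₁' G₂' : Fin d → defectSpaceAdj (tupleProd T) →L[ℂ] defectSpaceAdj (tupleProd T)}
    (hG : IsFundamentalAdj T G₁ G₂) (hG' : IsFundamentalAdj T G₁' G₂') (j : Fin d) :
    G₁ j = G₁' j ∧ G₂ j = G₂' j :=
  ⟨eq_of_defectAdj_comp_eq fun h => (hG j h).1.symm.trans (hG' j h).1,
    eq_of_defectAdj_comp_eq fun h => (hG j h).2.symm.trans (hG' j h).2⟩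

/-- The contractivity of the constructed pencils passes to any fundamental operators, by
uniqueness. -/
theorem IsFundamentalAdj.norm_mulPencil_le (hcomm : ∀ i j, Commute (T i) (T j))
    (hT : ∀ j, ‖T j‖ ≤ 1)
    {G₁ G₂ : Fin d → defectSpaceAdj (tupleProd T) →L[ℂ] defectSpaceAdj (tupleProd T)}
    (hG : IsFundamentalAdj T G₁ G₂) (j : Fin d) : ‖mulPencil ((G₁ j)†) (G₂ j)‖ ≤ 1 := by
  obtain ⟨G₁', G₂', hG', hn⟩ := exists_isFundamentalAdj hcomm hT
  rw [(hG.unique hG' j).1, (hG.unique hG' j).2]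
  exact hn j

theorem IsCanonicalUnitaryTuple.norm_le {R : Type*} [NormedAddCommGroup R] [InnerProductSpace ℂ R]
    [CompleteSpace R] {ι : asymptoticSpace (tupleProd T) →ₗᵢ[ℂ] R} {W : Fin d → R →L[ℂ] R}
    (hW : IsCanonicalUnitaryTuple T ι W) (j : Fin d) : ‖W j‖ ≤ 1 :=
  ContinuousLinearMap.opNorm_le_bound _ zero_le_one fun x => by
    rw [one_mul, norm_apply_of_mem_unitary (hW.unitary j)]

end Existence

end PseudoLift

theorem mainTheorem3 {H : Type u} [NormedAddCommGroup H] [InnerProductSpace ℂ H]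
    [CompleteSpace H] {d : ℕ} (T : Fin d → H →L[ℂ] H)
    (hcomm : ∀ i j, Commute (T i) (T j)) (hT : ∀ j, ‖T j‖ ≤ 1) :
    -- existence
    (∃ (K : Type u) (_ : NormedAddCommGroup K) (_ : InnerProductSpace ℂ K) (_ : CompleteSpace K)
      (P : H →ₗᵢ[ℂ] K) (S : Fin d → K →L[ℂ] K) (V : K →L[ℂ] K),
      PseudoLift.IsPseudoCommutativeContractiveLift T P S V ∧ ∀ j, ‖S j‖ ≤ 1) ∧
    -- the fundamental operators of the adjoint tuple exist and are unique
    (∃! G : Fin d →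
      (PseudoLift.defectSpaceAdj (PseudoLift.tupleProd T) →L[ℂ]
        PseudoLift.defectSpaceAdj (PseudoLift.tupleProd T)) ×
      (PseudoLift.defectSpaceAdj (PseudoLift.tupleProd T) →L[ℂ]
        PseudoLift.defectSpaceAdj (PseudoLift.tupleProd T)),
      PseudoLift.IsFundamentalAdj T (fun j => (G j).1) (fun j => (G j).2)) ∧
    -- a canonical unitary tuple exists
    (∃ (R : Type u) (_ : NormedAddCommGroup R) (_ : InnerProductSpace ℂ R) (_ : CompleteSpace R)
      (ι : PseudoLift.asymptoticSpace (PseudoLift.tupleProd T) →ₗᵢ[ℂ] R) (W : Fin d → R →L[ℂ] R),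
      PseudoLift.IsCanonicalUnitaryTuple T ι W) ∧
    -- the Douglas model built from these data is a lift
    (∀ (G₁ G₂ : Fin d → PseudoLift.defectSpaceAdj (PseudoLift.tupleProd T) →L[ℂ]
        PseudoLift.defectSpaceAdj (PseudoLift.tupleProd T)),
      PseudoLift.IsFundamentalAdj T G₁ G₂ →
      ∀ (R : Type v) [NormedAddCommGroup R] [InnerProductSpace ℂ R] [CompleteSpace R]
        (ι : PseudoLift.asymptoticSpace (PseudoLift.tupleProd T) →ₗᵢ[ℂ] R) (W : Fin d → R →L[ℂ] R),
      PseudoLift.IsCanonicalUnitaryTuple T ι W →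
      ∃ P : H →ₗᵢ[ℂ] WithLp 2
          (PseudoLift.Hardy (PseudoLift.defectSpaceAdj (PseudoLift.tupleProd T)) × R),
        (∀ (h : H) (n : ℕ), (P h).fst n = PseudoLift.defectAdjTo (PseudoLift.tupleProd T)
            ((((PseudoLift.tupleProd T)†) ^ n) h)) ∧
        (∀ h : H, (P h).snd = ι (PseudoLift.asymptoticRootTo (PseudoLift.tupleProd T) h)) ∧
        PseudoLift.IsPseudoCommutativeContractiveLift T P
          (fun j => PseudoLift.directSum (PseudoLift.mulPencil ((G₁ j)†) (G₂ j)) (W j))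
          (PseudoLift.directSum PseudoLift.mulZ (PseudoLift.tupleProd W)) ∧
        ∀ j, ‖PseudoLift.directSum (PseudoLift.mulPencil ((G₁ j)†) (G₂ j)) (W j)‖ ≤ 1) ∧
    -- uniqueness up to unitary equivalence
    (∀ (K₁ : Type w) [NormedAddCommGroup K₁] [InnerProductSpace ℂ K₁] [CompleteSpace K₁]
      (K₂ : Type x) [NormedAddCommGroup K₂] [InnerProductSpace ℂ K₂] [CompleteSpace K₂]
      (P₁ : H →ₗᵢ[ℂ] K₁) (S : Fin d → K₁ →L[ℂ] K₁) (V₁ : K₁ →L[ℂ] K₁)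
      (P₂ : H →ₗᵢ[ℂ] K₂) (R : Fin d → K₂ →L[ℂ] K₂) (V₂ : K₂ →L[ℂ] K₂),
      PseudoLift.IsPseudoCommutativeContractiveLift T P₁ S V₁ →
      PseudoLift.IsPseudoCommutativeContractiveLift T P₂ R V₂ →
      PseudoLift.UnitarilyEquivalent P₁ S V₁ P₂ R V₂) := by
  have hTn := PseudoLift.norm_tupleProd_le hT
  obtain ⟨G₁, G₂, hG, hGn⟩ := PseudoLift.exists_isFundamentalAdj hcomm hT
  obtain ⟨R, _, _, _, ι, W, hW⟩ := PseudoLift.exists_canonicalUnitaryTuple hcomm hT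
  refine ⟨⟨_, _, _, inferInstance, _, _, _,
      PseudoLift.isPseudoCommutativeContractiveLift_douglas hcomm hTn hG hW,
      fun j => PseudoLift.norm_directSum_le_one (hGn j) (hW.norm_le j)⟩,
    ⟨fun j => (G₁ j, G₂ j), hG, fun G' hG' => funext fun j =>
      Prod.ext (hG'.unique hG j).1 (hG'.unique hG j).2⟩,
    ⟨R, inferInstance, inferInstance, inferInstance, ι, W, hW⟩, ?_, ?_⟩
  · intro G₁ G₂ hG R _ _ _ ι W hW
    exact ⟨PseudoLift.douglasEmbedding hTn ι, PseudoLift.douglasEmbedding_fst hTn ι,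
      PseudoLift.douglasEmbedding_snd hTn ι,
      PseudoLift.isPseudoCommutativeContractiveLift_douglas hcomm hTn hG hW,
      fun j => PseudoLift.norm_directSum_le_one (hG.norm_mulPencil_le hcomm hT j) (hW.norm_le j)⟩
  · intro K₁ _ _ _ K₂ _ _ _ P₁ S V₁ P₂ R V₂ h₁ h₂
    exact h₁.unitarilyEquivalent h₂
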